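/- Let $\mathbb K$ be a field of characteristic $0$ or $\mathbb K=\mathbb Z$. Let $n,m\ge 0$, let $\mathbb P=\mathrm{Trop}(Z_1,\dots,Z_m)$ be the tropical semifield (the free abelian multiplicative group on $Z_1,\dots,Z_m$ with $\prod Z_i^{a_i}\oplus\prod Z_i^{b_i}=\prod Z_i^{\min(a_i,b_i)}$), let $\mathbb{KP}=\mathbb K[Z_1^{\pm1},\dots,Z_m^{\pm1}]$ be its group ring, and let $\mathcal F$ be a field of rational functions in $n$ independent variables with coefficients in $\mathbb{KP}$. A seed is a triple $(B,X,A)$, where $B=(b_{ij})$ is a skew-symmetrizable integer $n\times n$ matrix, $X=(X_1,\dots,X_n)\in\mathbb P^n$, and $A=(A_1,\dots,A_n)$ is a free generating set of the field $\mathcal F$ over $\mathbb{KP}$. Its mutation $\mu_k(B,X,A)=(B',X',A')$, for $k\in\{1,\dots,n\}$, is given by $$b'_{ij}=\begin{cases}-b_{ij}&\text{if } i=k\text{ or }j=k,\\ b_{ij}+\operatorname{sgn}(b_{ik})\max(b_{ik}b_{kj},0)&\text{otherwise,}\end{cases}\qquad X'_i=\begin{cases}X_k^{-1}&\text{if } i=k,\\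 X_iX_k^{\max(b_{ki},0)}(1\oplus X_k)^{-b_{ki}}&\text{if } i\ne k,\end{cases}$$ $$A'_i=A_i\ (i\neq k),\qquad A'_k=A_k^{-1}\Bigl(\tfrac{X_k}{1\oplus X_k}\prod_{b_{jk}>0}A_j^{b_{jk}}+\tfrac{1}{1\oplus X_k}\prod_{b_{jk}<0}A_j^{-b_{jk}}\Bigr).$$ Fix an initial seed $t_0=(B_{t_0},X_{t_0},A_{t_0})$ and let $t$ run over the seeds $(B_t,X_t,A_t)$, $A_t=(A_{1;t},\dots,A_{n;t})$, obtained from $t_0$ by finite sequences of mutations. The elements $A_{k;t}$ are the cluster variables, and the upper cluster algebra is $$\mathcal U=\bigcap_t \mathbb{KP}[A_{1;t}^{\pm1},\dots,A_{n;t}^{\pm1}]\subseteq\mathcal F .$$ Write $X_{k;t_0}=Z_1^{c_{1k}}\cdots Z_m^{c_{mk}}$ and $C=(c_{ik})$. Assume that the extended exchange matrix $\tilde B_{t_0}=\binom{B_{t_0}}{C}$, of size $(n+m)\times n$, has full rank $n$ and is primitive, i.e. the entries of each of its columns have greatest common divisor $1$. Then: (i) $\mathcal U$ is factorial (a unique factorization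 domain). (ii) Let $M$ be a cluster variable with $M\ne A_{i;t_0}$ for all $i$. Then $M$ can be written as $$M=\frac{P_M(A_{1;t_0},\dots,A_{n;t_0})}{A_{1;t_0}^{d_1}\cdots A_{n;t_0}^{d_n}}$$ with $d_1,\dots,d_n\in\mathbb Z$ and $P_M\in\mathbb{KP}[A_{1;t_0},\dots,A_{n;t_0}]$ not divisible by any $A_{j;t_0}$, and the numerator polynomial $P_M$ in such an expression lies in $\mathbb K[Z_1,\dots,Z_m][A_{1;t_0},\dots,A_{n;t_0}]$ and is irreducible in this ring. -/

import Mathlib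

noncomputable section

namespace ClusterAlgebra

/-- The underlying multiplicative group of the tropical semifield `Trop(Z_1, …, Z_m)`: the free
abelian group on `Z_1, …, Z_m`, a monomial being represented by its vector of exponents. -/
abbrev Trop (m : ℕ) : Type := Multiplicative (Fin m → ℤ)

namespace Trop

variable {m : ℕ}

/-- The exponents of a tropical monomial. -/
def exponent (x : Trop m) (i : Fin m) : ℤ := Multiplicative.toAdd x i

/-- The generator `Z_i`. -/
def gen (i : Fin m) : Trop m := Multiplicative.ofAdd (Pi.single i 1)

/-- The auxiliary addition: exponentwise minimum. -/
def oplus (x y : Trop m) : Trop m :=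
  Multiplicative.ofAdd fun i => min (x.exponent i) (y.exponent i)

end Trop

/-- The ring `𝕂ℙ`: the group ring over `K` of the group `ℙ = Trop(Z_1, …, Z_m)`, that is,
`K[Z_1^{±1}, …, Z_m^{±1}]`. -/
abbrev CoeffRing (K : Type*) [CommRing K] (m : ℕ) : Type _ := MonoidAlgebra K (Trop m)

/-- An integer square matrix is skew-symmetrizable if `S B` is skew-symmetric for some integer
diagonal matrix `S` with strictly positive diagonal entries. -/
def IsSkewSymmetrizable {n : ℕ} (B : Matrix (Fin n) (Fin n) ℤ) : Prop :=
  ∃ S : Fin n → ℤ, (∀ i, 0 < S i) ∧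
    (Matrix.diagonal S * B).transpose = -(Matrix.diagonal S * B)

/-- Mutation of the exchange matrix in direction `k`. -/
def mutateMatrix {n : ℕ} (k : Fin n) (B : Matrix (Fin n) (Fin n) ℤ) :
    Matrix (Fin n) (Fin n) ℤ :=
  fun i j => if i = k ∨ j = k then -B i j
    else B i j + (B i k).sign * max (B i k * B k j) 0

/-- The data `(B, X, A)` of a labeled seed of rank `n` over `ℙ = Trop(Z_1, …, Z_m)` with ambient
field `F`; the conditions on these data are in `Seed.IsASeed`. -/
structure Seed (n m : ℕ) (F : Type*) where
  /-- the exchange matrix -/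
  B : Matrix (Fin n) (Fin n) ℤ
  /-- the coefficient tuple -/
  X : Fin n → Trop m
  /-- the cluster -/
  A : Fin n → F

namespace Seed

variable {n m : ℕ} {F : Type*} [Field F]

/-- The conditions for `(B, X, A)` to be an `𝒜`-seed: `B` is skew-symmetrizable, and the cluster is
a free generating set of the field `F` over `𝕂ℙ`: it is algebraically independent over `𝕂ℙ`, and
`F` is generated as a field by `𝕂ℙ` and the cluster. In particular `F` is then a field of rational
functions in `n` independent variables with coefficients in `𝕂ℙ`. -/
structure IsASeed (K : Type*) [CommRing K] [Algebra (CoeffRing K m) F] (s : Seed n m F) :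
    Prop where
  skewSymmetrizable : IsSkewSymmetrizable s.B
  algebraicIndependent : AlgebraicIndependent (CoeffRing K m) s.A
  generates :
    Subfield.closure (Set.range (algebraMap (CoeffRing K m) F) ∪ Set.range s.A) = ⊤

/-- The coefficient matrix `C`, given by `X_k = Z_1^{c_{1k}} ⋯ Z_m^{c_{mk}}`. -/
def coeffMatrix (s : Seed n m F) : Matrix (Fin m) (Fin n) ℤ :=
  fun i k => (s.X k).exponent i

/-- The extended exchange matrix, with `B` on top of `C`. -/
def extendedMatrix (s : Seed n m F) : Matrix (Fin n ⊕ Fin m) (Fin n) ℤ :=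
  Matrix.fromRows s.B s.coeffMatrix

/-- The extended exchange matrix, which has `n + m` rows and `n` columns, has full rank. -/
def FullRank (s : Seed n m F) : Prop :=
  (s.extendedMatrix.map (Int.cast : ℤ → ℚ)).rank = n

/-- Each column of the extended exchange matrix is primitive: its entries have greatest common
divisor `1`. -/
def Primitive (s : Seed n m F) : Prop :=
  ∀ k, Finset.univ.gcd (fun i => (s.extendedMatrix i k).natAbs) = 1

section Mutation

variable (K : Type*) [CommRing K] [Algebra (CoeffRing K m) F]

/-- A tropical monomial as an element of the ambient field. -/
def coeff (F : Type*) [Field F] [Algebra (CoeffRing K m) F] (p : Trop m) : F :=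
  algebraMap (CoeffRing K m) F (MonoidAlgebra.of K (Trop m) p)

/-- The `k`-th exchange binomial. Note that `(b).toNat` is `max b 0`. -/
def exchangeBinomial (s : Seed n m F) (k : Fin n) : F :=
  coeff K F (s.X k / Trop.oplus 1 (s.X k)) * ∏ j, s.A j ^ (s.B j k).toNat +
    coeff K F (1 / Trop.oplus 1 (s.X k)) * ∏ j, s.A j ^ (-s.B j k).toNat

/-- Mutation `μ_k` of seeds. -/
def mutate (k : Fin n) (s : Seed n m F) : Seed n m F where
  B := mutateMatrix k s.B
  X := fun i => if i = k then (s.X k)⁻¹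
    else s.X i * s.X k ^ max (s.B k i) 0 * Trop.oplus 1 (s.X k) ^ (-s.B k i)
  A := fun i => if i = k then (s.A k)⁻¹ * s.exchangeBinomial K k else s.A i

/-- The seed pattern with initial seed `s₀`. A vertex `t` of the `n`-regular tree is addressed by
the sequence of labels of the edges on a walk from `t₀` to `t` (last label first); walks with the
same end point differ by backtracking, which does not change the seed since each `μ_k` is an
involution. -/
def seedAt (s₀ : Seed n m F) : List (Fin n) → Seed n m F
  | [] => s₀
  | k :: t => (seedAt s₀ t).mutate K k

/-- The Laurent polynomial ring `𝕂ℙ[A_1^{±1}, …, A_n^{±1}]` of a seed, inside the ambient field. -/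
def laurentRing (s : Seed n m F) : Subalgebra (CoeffRing K m) F :=
  Algebra.adjoin (CoeffRing K m) (Set.range s.A ∪ Set.range fun i => (s.A i)⁻¹)

/-- The upper cluster algebra: the intersection of the Laurent polynomial rings of all seeds of
the seed pattern with initial seed `s₀`. -/
def upperClusterAlgebra (s₀ : Seed n m F) : Subalgebra (CoeffRing K m) F :=
  ⨅ t : List (Fin n), (s₀.seedAt K t).laurentRing K

/-- The set of cluster variables `A_{k;t}` of the seed pattern with initial seed `s₀`. -/
def clusterVariables (s₀ : Seed n m F) : Set F :=
  {M | ∃ (t : List (Fin n)) (k : Fin n), M = (s₀.seedAt K t).A k}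

/-- `P` is the numerator polynomial and `d` is the `d`-vector of `M` with respect to the cluster of
`s`: one has `M = P(A_1, …, A_n) / (A_1^{d_1} ⋯ A_n^{d_n})`, where `P` is a polynomial over `𝕂ℙ`
which is not divisible by any of the variables. -/
def IsNumerator (s : Seed n m F) (M : F) (d : Fin n → ℤ)
    (P : MvPolynomial (Fin n) (CoeffRing K m)) : Prop :=
  (∀ j, ¬ MvPolynomial.X j ∣ P) ∧ M = MvPolynomial.aeval s.A P / ∏ j, s.A j ^ d j

end Mutation

end Seed

/-- The inclusion of `K[Z_1, …, Z_m]` into `𝕂ℙ = K[Z_1^{±1}, …, Z_m^{±1}]`. -/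
def polyToCoeffRing (K : Type*) [CommRing K] (m : ℕ) :
    MvPolynomial (Fin m) K →+* CoeffRing K m :=
  (MvPolynomial.aeval fun i => MonoidAlgebra.of K (Trop m) (Trop.gen i) :
    MvPolynomial (Fin m) K →ₐ[K] CoeffRing K m).toRingHom

/-- The inclusion of `K[Z_1, …, Z_m][A_1, …, A_n]` into `𝕂ℙ[A_1, …, A_n]`. -/
def polyInclusion (K : Type*) [CommRing K] (n m : ℕ) :
    MvPolynomial (Fin n) (MvPolynomial (Fin m) K) →+* MvPolynomial (Fin n) (CoeffRing K m) :=
  MvPolynomial.map (polyToCoeffRing K m)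

end ClusterAlgebra

end

/-!
The coefficient variables `Z_1, …, Z_m` are treated as frozen variables: adjoined to the cluster
they form the extended cluster of a seed, whose exchange relations are governed by the columns of
the extended exchange matrix. Primitivity and linear independence of these columns, and algebraic
independence of the extended cluster over `K`, are stable under mutation
(`Seed.IsPrimitiveSeed.mutate`), so every seed of the pattern has them.

*The upper cluster algebra at one seed.* Since its exponent vector is primitive, an exchange
binomial is prime in the Laurent polynomial ring: up to a monomial it is `1 + X ^ e`, and it
generates the kernel of the substitution `X ^ e ↦ -1` (`LaurentRing.prime_binomial`). Since the
columns are pairwise not proportional, the binomials at two directions are not associated. From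
this it follows that an element which is Laurent at a seed and at all its neighbours is Laurent at
the neighbours of the neighbours (`mem_laurent_update_update`), so that `𝒰` is the intersection of
the Laurent polynomial rings of any one seed and its neighbours
(`Seed.IsPrimitiveSeed.mem_upperClusterAlgebra_iff`). The algebra behind this step is that `f` is
Laurent over `S` in both `x` and `P / x` exactly when `x ^ N f` lies in the ideal `(x, P) ^ N` of
`S[x]` for some `N`, and that these ideals are primary if `P` is prime
(`LaurentOver.exchange_transfer`).

*Factoriality.* In the Laurent polynomial ring of the neighbour in direction `k` the variable `A_k`
is an exchange binomial up to a unit, hence is prime, while it is a unit at the seed itself and at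
the other neighbours. So `𝒰` is obtained from a factorial ring, the Laurent polynomial ring of the
seed, by imposing integrality at finitely many discrete valuations with uniformizers `A_k` in `𝒰`.
Such a ring is factorial; its primes are the `A_k` and the primes of the Laurent polynomial ring,
normalized by a monomial (`IsPrimeGluing.uniqueFactorizationMonoid`). As the seed is arbitrary,
every cluster variable is prime in `𝒰`.

*Numerators.* A cluster variable `M` is therefore either associated in `𝒰` to an initial cluster
variable `A_i`, or prime in the initial Laurent polynomial ring over `K`. To control scalars and
powers of the `Z_j`, expand the elements of all extended clusters in the initial one and compare
leading terms for a monomial order: the leading coefficients are `1` and the leading exponents of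
an extended cluster are linearly independent, because in an exchange relation the leading terms of
the two monomials are then distinct and cannot cancel; for an order that looks at `Z_j` first one
also sees that the least exponent of `Z_j` in a cluster variable is `0`
(`Seed.IsPrimitiveSeed.exists_isLeadingTerm`). In the first case this forces `M = A_i`. In the
second case `M` is a monomial in the `A_i` times a polynomial over `K` in the `A_i` and `Z_j`,
which no variable divides and which is irreducible because it is so as a Laurent polynomial
(`Seed.IsPrimitiveSeed.exists_irreducible_aeval_eq`).
-/

namespace ClusterAlgebra

open Polynomial

/-! ### Laurent polynomials in one variable over a subring -/

section LaurentOver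

variable {K F : Type*} [CommRing K] [Field F] [Algebra K F]

/-- The element `f` is a Laurent polynomial in `z` with coefficients in the subring `S`. -/
def LaurentOver (S : Subalgebra K F) (z f : F) : Prop :=
  ∃ (N : ℕ) (p : S[X]), z ^ N * f = aeval z p

/-- Membership of a polynomial `q` in the `N`-th power of the ideal `(X, P)`, read off from the
coefficients of `q`. -/
def MemPowIdeal {S : Type*} [CommRing S] (P : S) (N : ℕ) (q : S[X]) : Prop :=
  ∀ i, P ^ (N - i) ∣ q.coeff i

namespace MemPowIdeal

variable {S : Type*} [CommRing S] {P : S}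

lemma of_zero (q : S[X]) : MemPowIdeal P 0 q := fun i => by simp

lemma add {N : ℕ} {q r : S[X]} (hq : MemPowIdeal P N q) (hr : MemPowIdeal P N r) :
    MemPowIdeal P N (q + r) := fun i => by
  rw [coeff_add]; exact dvd_add (hq i) (hr i)

lemma mul {M N : ℕ} {q r : S[X]} (hq : MemPowIdeal P M q) (hr : MemPowIdeal P N r) :
    MemPowIdeal P (M + N) (q * r) := fun i => by
  rw [coeff_mul]
  refine Finset.dvd_sum fun ab hab => ?_
  have hab' : ab.1 + ab.2 = i := by simpa using hab
  have h := mul_dvd_mul (hq ab.1) (hr ab.2)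
  rw [← pow_add] at h
  exact (pow_dvd_pow P (by omega)).trans h

lemma mono {M N : ℕ} (h : M ≤ N) {q : S[X]} (hq : MemPowIdeal P N q) : MemPowIdeal P M q :=
  fun i => (pow_dvd_pow P (by omega)).trans (hq i)

lemma X : MemPowIdeal P 1 (X : S[X]) := fun i => by
  rcases i with _ | i <;> simp

lemma C : MemPowIdeal P 1 (Polynomial.C P) := fun i => by
  rcases i with _ | i <;> simp

/-- The powers of `(X, P)` are primary when `P` is prime: a polynomial whose constant term is not
divisible by `P` can be cancelled. -/
lemma of_mul [IsDomain S] (hP : Prime P) {N : ℕ} {h q : S[X]} (h0 : ¬ P ∣ h.coeff 0)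
    (hq : MemPowIdeal P N (h * q)) : MemPowIdeal P N q := by
  intro i
  induction i using Nat.strong_induction_on with
  | _ i ih =>
    have h1 := hq i
    have h0i : ((0, i) : ℕ × ℕ) ∈ Finset.HasAntidiagonal.antidiagonal i := by simp
    rw [coeff_mul, ← Finset.add_sum_erase _ _ h0i] at h1
    have h2 : P ^ (N - i) ∣ ∑ x ∈ (Finset.HasAntidiagonal.antidiagonal i).erase (0, i),
        h.coeff x.1 * q.coeff x.2 := by
      refine Finset.dvd_sum fun ab hab => ?_
      rw [Finset.mem_erase, Finset.HasAntidiagonal.mem_antidiagonal] at hab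
      have hlt : ab.2 < i := by
        rcases Nat.eq_zero_or_pos ab.1 with h | h
        · exact absurd (Prod.ext h (by simp; omega)) hab.1
        · omega
      exact ((pow_dvd_pow P (by omega)).trans (ih _ hlt)).mul_left _
    exact hP.pow_dvd_of_dvd_mul_left _ h0 ((dvd_add_left h2).mp h1)

lemma of_pow_mul [IsDomain S] (hP : Prime P) {N : ℕ} {h q : S[X]} (h0 : ¬ P ∣ h.coeff 0) (M : ℕ)
    (hq : MemPowIdeal P N (h ^ M * q)) : MemPowIdeal P N q := by
  induction M with
  | zero => simpa using hq
  | succ M ih => exact ih (of_mul hP h0 (by rwa [← mul_assoc, ← pow_succ']))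

end MemPowIdeal

variable {S S' : Subalgebra K F} {x f : F}

/-- If `f` is a Laurent polynomial over `S` both in `x` and in `P / x`, then after multiplication
by a power `x ^ N` it lies in the `N`-th power of the ideal `(x, P)`. -/
lemma LaurentOver.exists_memPowIdeal (hx : Transcendental S x) {P : S} (hP : P ≠ 0)
    (h1 : LaurentOver S x f) (h2 : LaurentOver S ((P : F) / x) f) :
    ∃ (N : ℕ) (p : S[X]), x ^ N * f = aeval x p ∧ MemPowIdeal P N p := by
  obtain ⟨a, p, hp⟩ := h1
  obtain ⟨b, q, hq⟩ := h2
  have hx0 : x ≠ 0 := by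
    rintro rfl; exact hx (isAlgebraic_zero)
  set d := q.natDegree with hd
  refine ⟨a + d, Polynomial.X ^ d * p, ?_, ?_⟩
  · rw [map_mul, map_pow, aeval_X, ← hp]; ring
  have key : Polynomial.C (P ^ b) * (Polynomial.X ^ d * p) =
      ∑ j ∈ Finset.range (d + 1),
        Polynomial.C (q.coeff j * P ^ j) * Polynomial.X ^ (a + d + b - j) := by
    apply transcendental_iff_injective.mp hx
    rw [map_mul, aeval_C, map_mul, map_pow (aeval x) Polynomial.X, aeval_X, ← hp, map_sum]
    have e1 : algebraMap S F (P ^ b) * (x ^ d * (x ^ a * f)) =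
        x ^ (a + d + b) * (((P : F) / x) ^ b * f) := by
      rw [show algebraMap S F (P ^ b) = (P : F) ^ b from rfl, div_pow]
      field_simp
      ring
    rw [e1, hq, aeval_eq_sum_range, Finset.mul_sum]
    refine Finset.sum_congr rfl fun j hj => ?_
    have hj' : j ≤ d := by simpa [Nat.lt_succ_iff] using hj
    rw [map_mul, map_pow, aeval_X, aeval_C, Algebra.smul_def, map_mul, map_pow]
    rw [show algebraMap S F P = (P : F) from rfl, div_pow]
    obtain ⟨c, hc⟩ : ∃ c, a + d + b = j + c := ⟨a + d + b - j, by omega⟩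
    rw [hc, Nat.add_sub_cancel_left, pow_add]
    field_simp
  intro i
  rcases lt_or_ge (a + d) i with hi | hi
  · simp [Nat.sub_eq_zero_of_le hi.le]
  have h3 := congrArg (fun r => r.coeff i) key
  simp only [coeff_C_mul, finsetSum_coeff, coeff_X_pow] at h3
  have h4 : P ^ b * P ^ (a + d - i) ∣ P ^ b * (Polynomial.X ^ d * p).coeff i := by
    rw [h3, ← pow_add]
    refine Finset.dvd_sum fun j hj => ?_
    have hj' : j ≤ d := by simpa [Nat.lt_succ_iff] using hj
    split_ifs with hij
    · rw [mul_one]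
      exact (pow_dvd_pow P (by omega)).mul_left _
    · simp
  exact (mul_dvd_mul_iff_left (pow_ne_zero _ hP)).mp h4

/-- Converse of `LaurentOver.exists_memPowIdeal`. -/
lemma LaurentOver.of_memPowIdeal (hx0 : x ≠ 0) {P : S} {N : ℕ} {p : S[X]}
    (hp : x ^ N * f = aeval x p) (h : MemPowIdeal P N p) : LaurentOver S ((P : F) / x) f := by
  choose r hr using h
  set d := p.natDegree with hd
  refine ⟨d, ∑ i ∈ Finset.range (d + 1),
    Polynomial.C (r i * P ^ (i - N)) * Polynomial.X ^ (d + N - i), ?_⟩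
  apply mul_left_cancel₀ (pow_ne_zero N hx0)
  rw [mul_left_comm, hp, aeval_eq_sum_range, map_sum, Finset.mul_sum, Finset.mul_sum]
  refine Finset.sum_congr rfl fun i hi => ?_
  have hi' : i ≤ d := by simpa [Nat.lt_succ_iff] using hi
  rw [map_mul, map_pow, aeval_X, aeval_C, Algebra.smul_def, hr i, map_mul, map_mul, map_pow,
    map_pow]
  rw [show algebraMap S F P = (P : F) from rfl]
  obtain ⟨y, hy⟩ : ∃ y, (P : F) = x * y := ⟨(P : F) / x, by field_simp⟩
  rw [hy, mul_div_cancel_left₀ y hx0, mul_pow, mul_pow]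
  rcases le_total i N with hiN | hiN
  · obtain ⟨c, rfl⟩ := Nat.exists_eq_add_of_le hiN
    rw [Nat.sub_eq_zero_of_le hiN, Nat.add_sub_cancel_left, show d + (i + c) - i = d + c by omega]
    ring
  · obtain ⟨c, rfl⟩ := Nat.exists_eq_add_of_le hiN
    obtain ⟨e, he⟩ := Nat.exists_eq_add_of_le hi'
    rw [Nat.sub_eq_zero_of_le hiN, Nat.add_sub_cancel_left, he,
      show N + c + e + N - (N + c) = e + N by omega]
    ring

/-- Comparison of two exchanges at the same variable `x`, over two coefficient rings `S` and `S'`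
with exchange polynomials `P` and `P'`. Up to inverting an element `h` of `S'[x]` lying outside the
prime ideal `(x, P')`, the ring `S` is contained in `S'[x]` and `P` lies in `(x, P')`; then a
Laurent polynomial over both `S` and `S'` that stays Laurent after the first exchange also stays
Laurent after the second one. -/
lemma LaurentOver.exchange_transfer (hx : Transcendental S x) (hx' : Transcendental S' x)
    {P : S} (hP : P ≠ 0) {P' : S'} (hP' : Prime P') {h : S'[X]} (h0 : ¬ P' ∣ h.coeff 0)
    (hS : ∀ s ∈ S, ∃ (M : ℕ) (q : S'[X]), aeval x h ^ M * s = aeval x q)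
    (hPP' : ∃ (M : ℕ) (q : S'[X]), aeval x h ^ M * P = aeval x q ∧ MemPowIdeal P' 1 q)
    (h1 : LaurentOver S x f) (h2 : LaurentOver S ((P : F) / x) f) (h3 : LaurentOver S' x f) :
    LaurentOver S' ((P' : F) / x) f := by
  have hx0 : x ≠ 0 := by
    rintro rfl; exact hx (isAlgebraic_zero)
  obtain ⟨N, p, hp, hpN⟩ := h1.exists_memPowIdeal hx hP h2
  -- `G n` is the `n`-th power of the ideal `(x, P')` of `S'[x]`, localized at `h`.
  let G : ℕ → F → Prop := fun n g =>
    ∃ (M : ℕ) (q : S'[X]), aeval x h ^ M * g = aeval x q ∧ MemPowIdeal P' n q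
  have Gmul : ∀ {m n a b}, G m a → G n b → G (m + n) (a * b) := by
    rintro m n a b ⟨M, q, hq, hq'⟩ ⟨M', r, hr, hr'⟩
    refine ⟨M + M', q * r, ?_, hq'.mul hr'⟩
    rw [map_mul, ← hq, ← hr]; ring
  have Gadd : ∀ {n a b}, G n a → G n b → G n (a + b) := by
    rintro n a b ⟨M, q, hq, hq'⟩ ⟨M', r, hr, hr'⟩
    refine ⟨M + M', h ^ M' * q + h ^ M * r, ?_, ?_⟩
    · rw [map_add, map_mul, map_mul, ← hq, ← hr, map_pow, map_pow]; ring
    · have e1 := (MemPowIdeal.of_zero (P := P') (h ^ M')).mul hq'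
      have e2 := (MemPowIdeal.of_zero (P := P') (h ^ M)).mul hr'
      rw [zero_add] at e1 e2
      exact e1.add e2
  have Gone : G 0 1 := ⟨0, 1, by simp, MemPowIdeal.of_zero _⟩
  have Gpow : ∀ {a}, G 1 a → ∀ n, G n (a ^ n) := by
    intro a ha n
    induction n with
    | zero => simpa using Gone
    | succ n ih => rw [pow_succ]; exact Gmul ih ha
  have Gmono : ∀ {m n a}, m ≤ n → G n a → G m a := by
    rintro m n a hmn ⟨M, q, hq, hq'⟩
    exact ⟨M, q, hq, hq'.mono hmn⟩
  have Gx : G 1 x := ⟨0, Polynomial.X, by simp, MemPowIdeal.X⟩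
  have GP : G 1 (P : F) := hPP'
  have GS : ∀ s : S, G 0 (s : F) := by
    intro s
    obtain ⟨M, q, hq⟩ := hS s s.2
    exact ⟨M, q, hq, MemPowIdeal.of_zero _⟩
  have Gf : G N (x ^ N * f) := by
    rw [hp, aeval_eq_sum_range]
    refine Finset.sum_induction _ (G N) (fun _ _ => Gadd) ⟨0, 0, by simp, fun i => by simp⟩ ?_
    intro i _
    obtain ⟨r, hr⟩ := hpN i
    have e : p.coeff i • x ^ i = (r : F) * ((P : F) ^ (N - i) * x ^ i) := by
      rw [Algebra.smul_def, show algebraMap S F (p.coeff i) = ((p.coeff i : S) : F) from rfl, hr]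
      push_cast; ring
    rw [e]
    have := Gmul (GS r) (Gmul (Gpow GP (N - i)) (Gpow Gx i))
    exact Gmono (by omega) this
  obtain ⟨N', q', hq'⟩ := h3
  obtain ⟨M, q, hq, hqm⟩ := Gmul (Gpow Gx N') Gf
  have e : q = h ^ M * (Polynomial.X ^ N * q') := by
    apply transcendental_iff_injective.mp hx'
    rw [← hq, map_mul, map_mul, map_pow, map_pow, aeval_X, ← hq']
    ring
  rw [e] at hqm
  refine LaurentOver.of_memPowIdeal (N := N' + N) (p := Polynomial.X ^ N * q') hx0 ?_
    (MemPowIdeal.of_pow_mul hP' h0 M hqm)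
  rw [map_mul, map_pow, aeval_X, ← hq']; ring

end LaurentOver

/-! ### The ring of Laurent polynomials -/

/-- The ring of Laurent polynomials over `K` in variables indexed by `ι`, as the group ring of
`ι → ℤ`. -/
abbrev LaurentRing (K ι : Type*) [CommRing K] : Type _ := AddMonoidAlgebra K (ι → ℤ)

namespace LaurentRing

variable {K ι : Type*} [CommRing K]

/-- The inclusion of the polynomial ring into the Laurent polynomial ring. -/
noncomputable def ofMvPolynomial (K ι : Type*) [CommRing K] :
    MvPolynomial ι K →ₐ[K] LaurentRing K ι :=
  AddMonoidAlgebra.mapDomainAlgHom K K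
    { toFun := fun e i => (e i : ℤ)
      map_zero' := by ext; simp
      map_add' := fun _ _ => by ext; simp }

lemma ofMvPolynomial_monomial (e : ι →₀ ℕ) (r : K) :
    ofMvPolynomial K ι (MvPolynomial.monomial e r) =
      AddMonoidAlgebra.single (fun i => (e i : ℤ)) r := by
  change AddMonoidAlgebra.mapDomainAlgHom K K _ (AddMonoidAlgebra.single e r) = _
  rw [AddMonoidAlgebra.mapDomainAlgHom_apply, AddMonoidAlgebra.mapDomain_single]
  rfl

lemma ofMvPolynomial_injective : Function.Injective (ofMvPolynomial K ι) := by
  intro a b h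
  rw [ofMvPolynomial, AddMonoidAlgebra.mapDomainAlgHom_apply,
    AddMonoidAlgebra.mapDomainAlgHom_apply] at h
  refine AddMonoidAlgebra.mapDomain_injective (fun e e' h => ?_) h
  ext i
  exact Int.ofNat_inj.mp (congrFun h i)

lemma exists_mul_single_eq [Fintype ι] (f : LaurentRing K ι) :
    ∃ (e : ι →₀ ℕ) (p : MvPolynomial ι K),
      f * AddMonoidAlgebra.single (fun i => (e i : ℤ)) 1 = ofMvPolynomial K ι p := by
  induction f using AddMonoidAlgebra.induction_linear with
  | zero => exact ⟨0, 0, by simp⟩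
  | add f g hf hg =>
    obtain ⟨e, p, hp⟩ := hf
    obtain ⟨e', q, hq⟩ := hg
    refine ⟨e + e', p * MvPolynomial.monomial e' 1 + q * MvPolynomial.monomial e 1, ?_⟩
    rw [map_add, map_mul, map_mul, ← hp, ← hq, ofMvPolynomial_monomial, ofMvPolynomial_monomial,
      mul_assoc, mul_assoc, AddMonoidAlgebra.single_mul_single, AddMonoidAlgebra.single_mul_single,
      add_mul, mul_one]
    congr 3
    ext i
    simp [add_comm]
  | single a r =>
    refine ⟨Finsupp.equivFunOnFinite.symm fun i => (-a i).toNat,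
      MvPolynomial.monomial (Finsupp.equivFunOnFinite.symm fun i => (a i).toNat) r, ?_⟩
    rw [ofMvPolynomial_monomial, AddMonoidAlgebra.single_mul_single, mul_one]
    congr 1
    ext i
    simp
    omega

lemma isUnit_single (a : ι → ℤ) : IsUnit (AddMonoidAlgebra.single a 1 : LaurentRing K ι) := by
  refine IsUnit.of_mul_eq_one (AddMonoidAlgebra.single (-a) 1) ?_
  rw [AddMonoidAlgebra.single_mul_single, add_neg_cancel, mul_one, AddMonoidAlgebra.one_def]

/-- A Laurent polynomial ring over a unique factorization domain is a localization of a polynomial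
ring, hence is a unique factorization domain. -/
lemma uniqueFactorizationMonoid [Fintype ι] [IsDomain K] [UniqueFactorizationMonoid K] :
    UniqueFactorizationMonoid (LaurentRing K ι) := by
  let _ : Algebra (MvPolynomial ι K) (LaurentRing K ι) := (ofMvPolynomial K ι).toRingHom.toAlgebra
  let S : Submonoid (MvPolynomial ι K) :=
    { carrier := Set.range fun e : ι →₀ ℕ => MvPolynomial.monomial e 1
      one_mem' := ⟨0, rfl⟩
      mul_mem' := by
        rintro _ _ ⟨e, rfl⟩ ⟨e', rfl⟩
        exact ⟨e + e', by simp [MvPolynomial.monomial_mul]⟩ }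
  have hloc : IsLocalization S (LaurentRing K ι) := by
    constructor
    refine ⟨?_, ?_, ?_⟩
    · rintro ⟨_, e, rfl⟩
      change IsUnit (ofMvPolynomial K ι (MvPolynomial.monomial e 1))
      rw [ofMvPolynomial_monomial]
      exact isUnit_single _
    · intro f
      obtain ⟨e, p, hp⟩ := exists_mul_single_eq f
      refine ⟨(p, ⟨MvPolynomial.monomial e 1, e, rfl⟩), ?_⟩
      change f * ofMvPolynomial K ι (MvPolynomial.monomial e 1) = ofMvPolynomial K ι p
      rw [ofMvPolynomial_monomial, hp]
    · intro a b h
      refine ⟨1, ?_⟩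
      rw [ofMvPolynomial_injective (K := K) (ι := ι) h]
  exact UniqueFactorizationMonoid.of_isLocalization S (LaurentRing K ι)

section Binomial

variable (K) in
/-- The endomorphism of the Laurent polynomial ring that substitutes `-1` for the monomial with
exponent `e`, relative to the splitting of `ℤ e` off `ι → ℤ` given by a linear form `φ`
with `φ e = 1`. Its kernel is the ideal generated by `1 + X ^ e`. -/
noncomputable def substNegOne (e : ι → ℤ) (φ : (ι → ℤ) →+ ℤ) :
    LaurentRing K ι →ₐ[K] LaurentRing K ι :=
  AddMonoidAlgebra.lift K _ _
    { toFun := fun a => AddMonoidAlgebra.single (a.toAdd - φ a.toAdd • e)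
        (((-1 : Kˣ) ^ φ a.toAdd : Kˣ) : K)
      map_one' := by simp [AddMonoidAlgebra.one_def]
      map_mul' := fun a b => by
        rw [AddMonoidAlgebra.single_mul_single, toAdd_mul, map_add, zpow_add, Units.val_mul]
        congr 1
        module }

variable {e : ι → ℤ} {φ : (ι → ℤ) →+ ℤ}

lemma substNegOne_single (a : ι → ℤ) (r : K) :
    substNegOne K e φ (AddMonoidAlgebra.single a r) =
      AddMonoidAlgebra.single (a - φ a • e) (r * (((-1 : Kˣ) ^ φ a : Kˣ) : K)) := by
  rw [substNegOne, AddMonoidAlgebra.lift_single]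
  simp [AddMonoidAlgebra.smul_single]

lemma substNegOne_binomial (hφ : φ e = 1) :
    substNegOne K e φ (1 + AddMonoidAlgebra.single e 1) = 0 := by
  rw [map_add, map_one, substNegOne_single, hφ, one_smul, sub_self, zpow_one, Units.val_neg,
    Units.val_one, one_mul, AddMonoidAlgebra.one_def, ← AddMonoidAlgebra.single_add]
  simp

lemma binomial_dvd_sub_substNegOne (f : LaurentRing K ι) :
    (1 + AddMonoidAlgebra.single e 1 : LaurentRing K ι) ∣ f - substNegOne K e φ f := by
  set p : LaurentRing K ι := 1 + AddMonoidAlgebra.single e 1 with hp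
  set q := Ideal.Quotient.mk (Ideal.span {p})
  have hq : q (AddMonoidAlgebra.single e 1) = -1 := by
    rw [eq_neg_iff_add_eq_zero, ← map_one q, ← map_add, add_comm, Ideal.Quotient.eq_zero_iff_mem]
    exact Ideal.mem_span_singleton_self p
  have key : ∀ z : ℤ, q (AddMonoidAlgebra.single (z • e) 1) =
      q (AddMonoidAlgebra.single 0 (((-1 : Kˣ) ^ z : Kˣ) : K)) := by
    have step1 : ∀ z : ℤ, q (AddMonoidAlgebra.single ((z + 1) • e) 1) =
        -q (AddMonoidAlgebra.single (z • e) 1) := fun z => by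
      have h : (AddMonoidAlgebra.single ((z + 1) • e) 1 : LaurentRing K ι) =
          AddMonoidAlgebra.single (z • e) 1 * AddMonoidAlgebra.single e 1 := by
        rw [AddMonoidAlgebra.single_mul_single, mul_one, add_smul, one_smul]
      rw [h, map_mul, hq]
      ring
    have step2 : ∀ z : ℤ, q (AddMonoidAlgebra.single 0 (((-1 : Kˣ) ^ (z + 1) : Kˣ) : K)) =
        -q (AddMonoidAlgebra.single 0 (((-1 : Kˣ) ^ z : Kˣ) : K)) := fun z => by
      rw [zpow_add, zpow_one, ← map_neg, ← AddMonoidAlgebra.single_neg]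
      simp
    intro z
    induction z using Int.induction_on with
    | zero => simp
    | succ z ih => rw [step1, step2, ih]
    | pred z ih =>
      have h1 := step1 (-(z : ℤ) - 1)
      have h2 := step2 (-(z : ℤ) - 1)
      rw [sub_add_cancel] at h1 h2
      rw [← neg_inj, ← h1, ← h2, ih]
  rw [← Ideal.mem_span_singleton, ← Ideal.Quotient.eq_zero_iff_mem, map_sub, sub_eq_zero]
  induction f using AddMonoidAlgebra.induction_linear with
  | zero => simp
  | add f g hf hg => rw [map_add, map_add, map_add, ← hf, ← hg]
  | single a r =>
    have h1 : (AddMonoidAlgebra.single a r : LaurentRing K ι) =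
        AddMonoidAlgebra.single (a - φ a • e) r * AddMonoidAlgebra.single (φ a • e) 1 := by
      rw [AddMonoidAlgebra.single_mul_single, mul_one, sub_add_cancel]
    have h2 : substNegOne K e φ (AddMonoidAlgebra.single a r) =
        AddMonoidAlgebra.single (a - φ a • e) r *
          AddMonoidAlgebra.single 0 (((-1 : Kˣ) ^ φ a : Kˣ) : K) := by
      rw [substNegOne_single, AddMonoidAlgebra.single_mul_single, add_zero]
    rw [h2, h1, map_mul, map_mul, key]

lemma binomial_dvd_iff (hφ : φ e = 1) (f : LaurentRing K ι) :
    (1 + AddMonoidAlgebra.single e 1 : LaurentRing K ι) ∣ f ↔ substNegOne K e φ f = 0 := by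
  refine ⟨fun ⟨g, hg⟩ => ?_, fun h => ?_⟩
  · rw [hg, map_mul, substNegOne_binomial hφ, zero_mul]
  · simpa [h] using binomial_dvd_sub_substNegOne (e := e) (φ := φ) f

lemma one_add_single_ne_zero [Nontrivial K] {a : ι → ℤ} (ha : a ≠ 0) (r : K) :
    (1 + AddMonoidAlgebra.single a r : LaurentRing K ι) ≠ 0 := by
  intro h
  have := congrArg (fun f => f.coeff 0) h
  simp [AddMonoidAlgebra.one_def, ha] at this

/-- For a primitive vector `e`, the Laurent binomial `1 + X ^ e` is prime. -/
lemma prime_binomial [IsDomain K] (hφ : φ e = 1) :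
    Prime (1 + AddMonoidAlgebra.single e 1 : LaurentRing K ι) := by
  refine ⟨one_add_single_ne_zero (by rintro rfl; simp at hφ) 1, fun h => ?_, fun f g h => ?_⟩
  · have := h.map (substNegOne K e φ)
    rw [substNegOne_binomial hφ] at this
    exact not_isUnit_zero this
  · rw [binomial_dvd_iff hφ, map_mul, mul_eq_zero] at h
    exact h.imp (binomial_dvd_iff hφ f).mpr (binomial_dvd_iff hφ g).mpr

/-- A primitive Laurent binomial divides another one only if the exponents are proportional. -/
lemma exists_eq_smul_of_binomial_dvd [Nontrivial K] (hφ : φ e = 1) {g : ι → ℤ}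
    (h : (1 + AddMonoidAlgebra.single e 1 : LaurentRing K ι) ∣ 1 + AddMonoidAlgebra.single g 1) :
    ∃ c : ℤ, g = c • e := by
  rw [binomial_dvd_iff hφ, map_add, map_one, substNegOne_single] at h
  by_contra! hne
  exact one_add_single_ne_zero (sub_ne_zero.mpr (hne (φ g))) _ h

end Binomial

end LaurentRing

/-! ### Laurent polynomial subrings of a field -/

section Laurent

variable {K F ι : Type*} [CommRing K] [Field F] [Algebra K F]

variable (K) in
/-- The subring of `F` generated over `K` by the elements `x i` and their inverses, for `i`
in `T`. -/
def laurent (x : ι → F) (T : Set ι) : Subalgebra K F :=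
  Algebra.adjoin K (x '' T ∪ (fun i => (x i)⁻¹) '' T)

variable {x x' : ι → F} {T : Set ι}

lemma mem_laurent {i : ι} (hi : i ∈ T) : x i ∈ laurent K x T :=
  Algebra.subset_adjoin (Or.inl ⟨i, hi, rfl⟩)

lemma inv_mem_laurent {i : ι} (hi : i ∈ T) : (x i)⁻¹ ∈ laurent K x T :=
  Algebra.subset_adjoin (Or.inr ⟨i, hi, rfl⟩)

lemma zpow_mem_laurent {i : ι} (hi : i ∈ T) (n : ℤ) : x i ^ n ∈ laurent K x T := by
  rcases n with n | n
  · simpa using pow_mem (mem_laurent hi) n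
  · rw [zpow_negSucc, ← inv_pow]
    exact pow_mem (inv_mem_laurent hi) _

lemma laurent_le {D : Subalgebra K F} (h : ∀ i ∈ T, x i ∈ D ∧ (x i)⁻¹ ∈ D) :
    laurent K x T ≤ D := by
  refine Algebra.adjoin_le ?_
  rintro _ (⟨i, hi, rfl⟩ | ⟨i, hi, rfl⟩)
  exacts [(h i hi).1, (h i hi).2]

lemma laurent_mono {T' : Set ι} (h : T ⊆ T') : laurent K x T ≤ laurent K x T' :=
  laurent_le fun _ hi => ⟨mem_laurent (h hi), inv_mem_laurent (h hi)⟩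

lemma laurent_congr (h : ∀ i ∈ T, x i = x' i) : laurent K x T = laurent K x' T := by
  refine le_antisymm (laurent_le fun i hi => ?_) (laurent_le fun i hi => ?_)
  · rw [h i hi]; exact ⟨mem_laurent hi, inv_mem_laurent hi⟩
  · rw [← h i hi]; exact ⟨mem_laurent hi, inv_mem_laurent hi⟩

lemma transcendental_laurent [Nontrivial K] (hx : AlgebraicIndependent K x) {k : ι} (hk : k ∉ T) :
    Transcendental (laurent K x T) (x k) := fun h => by
  refine hx.transcendental_adjoin hk
    (IsAlgebraic.adjoin_of_forall_isAlgebraic (s := x '' T ∪ (fun i => (x i)⁻¹) '' T) ?_ h)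
  have halg : ∀ i ∈ T, IsAlgebraic (Algebra.adjoin K (x '' T)) (x i) := fun i hi =>
    isAlgebraic_algebraMap (⟨x i, Algebra.subset_adjoin ⟨i, hi, rfl⟩⟩ : Algebra.adjoin K (x '' T))
  rintro _ ⟨⟨i, hi, rfl⟩ | ⟨i, hi, rfl⟩, -⟩
  · exact halg i hi
  · exact (halg i hi).inv

/-- A Laurent polynomial in all the variables is a Laurent polynomial in one of them over the ring
of Laurent polynomials in the others. -/
lemma laurentOver_iff {k : ι} (hk : x k ≠ 0) {f : F} :
    LaurentOver (laurent K x {k}ᶜ) (x k) f ↔ f ∈ laurent K x Set.univ := by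
  constructor
  · rintro ⟨N, p, hp⟩
    have h1 : aeval (x k) p ∈ laurent K x Set.univ := by
      rw [aeval_eq_sum_range]
      refine sum_mem fun i _ => ?_
      rw [Algebra.smul_def]
      exact mul_mem (laurent_mono (Set.subset_univ _) (p.coeff i).2)
        (pow_mem (mem_laurent (Set.mem_univ k)) i)
    have h2 : f = (x k)⁻¹ ^ N * aeval (x k) p := by
      rw [← hp, inv_pow, inv_mul_cancel_left₀ (pow_ne_zero N hk)]
    rw [h2]
    exact mul_mem (pow_mem (inv_mem_laurent (Set.mem_univ k)) N) h1
  · intro hf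
    have hC : ∀ s : laurent K x {k}ᶜ, LaurentOver (laurent K x {k}ᶜ) (x k) (s : F) := fun s =>
      ⟨0, C s, by rw [aeval_C, pow_zero, one_mul]; rfl⟩
    have hadd : ∀ a b, LaurentOver (laurent K x {k}ᶜ) (x k) a →
        LaurentOver (laurent K x {k}ᶜ) (x k) b → LaurentOver (laurent K x {k}ᶜ) (x k) (a + b) := by
      rintro a b ⟨N, p, hp⟩ ⟨M, q, hq⟩
      refine ⟨N + M, X ^ M * p + X ^ N * q, ?_⟩
      rw [map_add, map_mul, map_mul, map_pow, map_pow, aeval_X, ← hp, ← hq]; ring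
    have hmul : ∀ a b, LaurentOver (laurent K x {k}ᶜ) (x k) a →
        LaurentOver (laurent K x {k}ᶜ) (x k) b → LaurentOver (laurent K x {k}ᶜ) (x k) (a * b) := by
      rintro a b ⟨N, p, hp⟩ ⟨M, q, hq⟩
      refine ⟨N + M, p * q, ?_⟩
      rw [map_mul, ← hp, ← hq]; ring
    induction hf using Algebra.adjoin_induction with
    | mem y hy =>
      rcases hy with ⟨i, -, rfl⟩ | ⟨i, -, rfl⟩
      · by_cases hik : i = k
        · subst hik; exact ⟨0, X, by simp⟩
        · exact hC ⟨x i, mem_laurent hik⟩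
      · by_cases hik : i = k
        · subst hik; exact ⟨1, 1, by simp [hk]⟩
        · exact hC ⟨(x i)⁻¹, inv_mem_laurent hik⟩
    | algebraMap r => exact hC (algebraMap K _ r)
    | add a b _ _ ha hb => exact hadd a b ha hb
    | mul a b _ _ ha hb => exact hmul a b ha hb

/-- A quotient of elements of the coefficient ring which is a Laurent polynomial lies in the
coefficient ring. -/
lemma LaurentOver.mem_of_mul_mem {S : Subalgebra K F} {z g : F} (hz : Transcendental S z) {P : S}
    (hP : P ≠ 0) (hg : LaurentOver S z g) (h : (P : F) * g ∈ S) : g ∈ S := by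
  obtain ⟨N, p, hp⟩ := hg
  have e : C P * p = C ⟨(P : F) * g, h⟩ * X ^ N := by
    apply transcendental_iff_injective.mp hz
    rw [map_mul, map_mul, aeval_C, aeval_C, ← hp, map_pow, aeval_X]
    change (P : F) * (z ^ N * g) = (P : F) * g * z ^ N
    ring
  have e2 := congrArg (fun q => q.coeff N) e
  simp only [coeff_C_mul, coeff_X_pow_self, mul_one] at e2
  have e3 : (P : F) * (p.coeff N : F) = P * g := congrArg Subtype.val e2
  rw [← mul_left_cancel₀ (by simpa using hP) e3]
  exact (p.coeff N).2

lemma algebraicIndependent_update [Nontrivial K] [DecidableEq ι] (hx : AlgebraicIndependent K x)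
    (k : ι) {P : F} (hP : P ∈ laurent K x {k}ᶜ) (hP0 : P ≠ 0) :
    AlgebraicIndependent K (Function.update x k (P / x k)) := by
  have hu : ({k}ᶜ : Set ι).EqOn (Function.update x k (P / x k)) x := fun i hi =>
    Function.update_of_ne hi _ _
  rw [← AlgebraicIndepOn.univ, show (Set.univ : Set ι) = insert k {k}ᶜ by ext; simp [em],
    AlgebraicIndepOn.insert_iff (by simp), Function.update_self, hu.image_eq]
  refine ⟨?_, fun h => ?_⟩
  · have h1 := hx.comp (fun i : ({k}ᶜ : Set ι) => (i : ι)) Subtype.val_injective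
    convert h1 using 1
    ext i
    exact hu i.2
  · refine transcendental_laurent hx (T := {k}ᶜ) (k := k) (by simp) ?_
    have h1 : IsAlgebraic (laurent K x {k}ᶜ) (P / x k) := by
      have hle : Algebra.adjoin K (x '' {k}ᶜ) ≤ laurent K x {k}ᶜ :=
        Algebra.adjoin_mono Set.subset_union_left
      refine IsAlgebraic.adjoin_of_forall_isAlgebraic (s := x '' {k}ᶜ) ?_ h
      rintro y ⟨hy, hy'⟩
      exact absurd (Or.inl hy) hy'
    have h2 : IsAlgebraic (laurent K x {k}ᶜ) P :=
      isAlgebraic_algebraMap (⟨P, hP⟩ : laurent K x {k}ᶜ)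
    have h3 := h2.mul h1.inv
    rwa [inv_div, mul_div_cancel₀ _ hP0] at h3

/-- Primality descends from the Laurent polynomial ring in all variables to the one omitting one
variable. -/
lemma prime_laurent_compl [IsDomain K] (hx : ∀ i, x i ≠ 0) (hind : AlgebraicIndependent K x)
    {k : ι} {P : F} (hPS : P ∈ laurent K x {k}ᶜ) (hPU : P ∈ laurent K x Set.univ)
    (hP : Prime (⟨P, hPU⟩ : laurent K x Set.univ)) :
    Prime (⟨P, hPS⟩ : laurent K x {k}ᶜ) := by
  have hP0 : P ≠ 0 := fun h => hP.ne_zero (Subtype.ext h)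
  have hle : laurent K x {k}ᶜ ≤ laurent K x Set.univ := laurent_mono (Set.subset_univ _)
  have hmem : ∀ g ∈ laurent K x Set.univ, P * g ∈ laurent K x {k}ᶜ → g ∈ laurent K x {k}ᶜ :=
    fun g hg h => LaurentOver.mem_of_mul_mem (transcendental_laurent hind (by simp))
      (P := ⟨P, hPS⟩) (fun h => hP0 (congrArg Subtype.val h)) ((laurentOver_iff (hx k)).mpr hg) h
  refine ⟨fun h => hP0 (congrArg Subtype.val h), fun h => hP.not_isUnit ?_, ?_⟩
  · obtain ⟨⟨g, hg⟩, hPg⟩ := h.exists_right_inv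
    have hPg' : P * g = 1 := congrArg Subtype.val hPg
    exact IsUnit.of_mul_eq_one ⟨g, hle hg⟩ (Subtype.ext hPg')
  · rintro ⟨a, ha⟩ ⟨b, hb⟩ ⟨⟨c, hc⟩, habc⟩
    have habc' : a * b = P * c := congrArg Subtype.val habc
    rcases hP.dvd_or_dvd (a := ⟨a, hle ha⟩) (b := ⟨b, hle hb⟩)
      ⟨⟨c, hle hc⟩, Subtype.ext habc'⟩ with ⟨⟨g, hg⟩, h⟩ | ⟨⟨g, hg⟩, h⟩
    · have h' : a = P * g := congrArg Subtype.val h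
      exact Or.inl ⟨⟨g, hmem g hg (h' ▸ ha)⟩, Subtype.ext h'⟩
    · have h' : b = P * g := congrArg Subtype.val h
      exact Or.inr ⟨⟨g, hmem g hg (h' ▸ hb)⟩, Subtype.ext h'⟩

lemma mem_laurent_update_iff [DecidableEq ι] {k : ι} {y f : F} (hy : y ≠ 0) :
    f ∈ laurent K (Function.update x k y) Set.univ ↔ LaurentOver (laurent K x {k}ᶜ) y f := by
  rw [← laurentOver_iff (k := k) (by simpa using hy), Function.update_self,
    laurent_congr (x := Function.update x k y) (x' := x) (T := {k}ᶜ)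
      fun i hi => Function.update_of_ne hi _ _]

/-- After inverting the exchange polynomial `P` at `p`, the Laurent polynomials in the old variables
other than `x k` are polynomials in `x k` over the Laurent polynomials in the new variables other
than `x k`. -/
lemma exists_pow_mul_eq_aeval [DecidableEq ι] {p k : ι} (hpk : p ≠ k) (hx : ∀ i, x i ≠ 0) {P : F}
    (hP0 : P ≠ 0)
    {h : (laurent K (Function.update x p (P / x p)) {k}ᶜ)[X]} (hh : aeval (x k) h = P) :
    ∀ s ∈ laurent K x {k}ᶜ, ∃ (M : ℕ) (q : (laurent K (Function.update x p (P / x p)) {k}ᶜ)[X]),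
      aeval (x k) h ^ M * s = aeval (x k) q := by
  rw [hh]
  have hp' : P / x p ∈ laurent K (Function.update x p (P / x p)) {k}ᶜ := by
    have := mem_laurent (K := K) (x := Function.update x p (P / x p)) (T := {k}ᶜ) (i := p) hpk
    rwa [Function.update_self] at this
  have hp'' : (P / x p)⁻¹ ∈ laurent K (Function.update x p (P / x p)) {k}ᶜ := by
    have := inv_mem_laurent (K := K) (x := Function.update x p (P / x p)) (T := {k}ᶜ) (i := p) hpk
    rwa [Function.update_self] at this
  have hxp := hx p
  intro s hs
  induction hs using Algebra.adjoin_induction with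
  | mem y hy =>
    rcases hy with ⟨i, hi, rfl⟩ | ⟨i, hi, rfl⟩
    · by_cases hip : i = p
      · subst hip
        refine ⟨0, h * C ⟨_, hp''⟩, ?_⟩
        rw [map_mul, hh, aeval_C]
        change _ = P * (P / x i)⁻¹
        field_simp
      · refine ⟨0, C ⟨x i, ?_⟩, ?_⟩
        · rw [← Function.update_of_ne hip (P / x p) x]; exact mem_laurent hi
        · rw [aeval_C, pow_zero, one_mul]; rfl
    · by_cases hip : i = p
      · subst hip
        refine ⟨1, C ⟨_, hp'⟩, ?_⟩
        rw [aeval_C, pow_one]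
        exact (div_eq_mul_inv P (x i)).symm
      · refine ⟨0, C ⟨(x i)⁻¹, ?_⟩, ?_⟩
        · have := inv_mem_laurent (K := K) (x := Function.update x p (P / x p)) (T := {k}ᶜ) hi
          rwa [Function.update_of_ne hip] at this
        · rw [aeval_C, pow_zero, one_mul]; rfl
  | algebraMap r => exact ⟨0, C (algebraMap K _ r), by rw [aeval_C, pow_zero, one_mul]; rfl⟩
  | add a b _ _ ha hb =>
    obtain ⟨M, q, hq⟩ := ha
    obtain ⟨N, r, hr⟩ := hb
    refine ⟨M + N, h ^ N * q + h ^ M * r, ?_⟩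
    rw [map_add, map_mul, map_mul, map_pow, map_pow, hh, ← hq, ← hr]; ring
  | mul a b _ _ ha hb =>
    obtain ⟨M, q, hq⟩ := ha
    obtain ⟨N, r, hr⟩ := hb
    refine ⟨M + N, q * r, ?_⟩
    rw [map_mul, ← hq, ← hr]; ring

variable [Fintype ι]

/-- The Laurent monomial in the family `x` with exponent vector `e`. -/
def mon (x : ι → F) (e : ι → ℤ) : F := ∏ i, x i ^ e i

lemma mon_ne_zero (hx : ∀ i, x i ≠ 0) (e : ι → ℤ) : mon x e ≠ 0 :=
  Finset.prod_ne_zero_iff.mpr fun i _ => zpow_ne_zero _ (hx i)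

lemma mon_add (hx : ∀ i, x i ≠ 0) (e e' : ι → ℤ) : mon x (e + e') = mon x e * mon x e' := by
  rw [mon, mon, mon, ← Finset.prod_mul_distrib]
  exact Finset.prod_congr rfl fun i _ => zpow_add₀ (hx i) _ _

@[simp] lemma mon_zero : mon x (0 : ι → ℤ) = 1 := by simp [mon]

lemma mon_neg (e : ι → ℤ) : mon x (-e) = (mon x e)⁻¹ := by
  simp [mon, zpow_neg]

lemma mon_smul (n : ℤ) (e : ι → ℤ) : mon x (n • e) = mon x e ^ n := by
  rw [mon, mon, ← Finset.prod_zpow]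
  exact Finset.prod_congr rfl fun i _ => by rw [Pi.smul_apply, smul_eq_mul, mul_comm, zpow_mul]

lemma mon_mem_laurent {e : ι → ℤ} (he : ∀ i ∉ T, e i = 0) : mon x e ∈ laurent K x T := by
  refine prod_mem fun i _ => ?_
  by_cases hi : i ∈ T
  · exact zpow_mem_laurent hi _
  · rw [he i hi, zpow_zero]; exact one_mem _

lemma mon_single [DecidableEq ι] (i : ι) (n : ℤ) : mon x (Pi.single i n) = x i ^ n := by
  rw [mon, Finset.prod_eq_single i]
  · simp
  · intro j _ hj; simp [hj]
  · simp

lemma mon_congr {e : ι → ℤ} (h : ∀ i, e i ≠ 0 → x i = x' i) : mon x e = mon x' e :=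
  Finset.prod_congr rfl fun i _ => by
    by_cases hi : e i = 0
    · simp [hi]
    · rw [h i hi]

variable (K) in
/-- The evaluation of Laurent polynomials at a family of nonzero elements of `F`. -/
noncomputable def laurentEval (x : ι → F) (hx : ∀ i, x i ≠ 0) : LaurentRing K ι →ₐ[K] F :=
  AddMonoidAlgebra.lift K _ _
    { toFun := fun e => mon x e.toAdd
      map_one' := mon_zero
      map_mul' := fun _ _ => mon_add hx _ _ }

lemma laurentEval_single (hx : ∀ i, x i ≠ 0) (e : ι → ℤ) (r : K) :
    laurentEval K x hx (AddMonoidAlgebra.single e r) = r • mon x e := by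
  rw [laurentEval, AddMonoidAlgebra.lift_single]
  rfl

lemma laurentEval_ofMvPolynomial (hx : ∀ i, x i ≠ 0) (p : MvPolynomial ι K) :
    laurentEval K x hx (LaurentRing.ofMvPolynomial K ι p) = MvPolynomial.aeval x p := by
  classical
  rw [← AlgHom.comp_apply]
  congr 1
  refine MvPolynomial.algHom_ext fun i => ?_
  rw [AlgHom.comp_apply, MvPolynomial.X, LaurentRing.ofMvPolynomial_monomial, laurentEval_single,
    one_smul, ← MvPolynomial.X, MvPolynomial.aeval_X]
  rw [show (fun j => ((Finsupp.single i 1 : ι →₀ ℕ) j : ℤ)) = Pi.single i 1 by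
    ext j; rw [Finsupp.single_apply, Pi.single_apply]; split_ifs <;> simp_all, mon_single, zpow_one]

lemma laurentEval_injective (hx : ∀ i, x i ≠ 0) (hind : AlgebraicIndependent K x) :
    Function.Injective (laurentEval K x hx) := by
  rw [injective_iff_map_eq_zero]
  intro f hf
  obtain ⟨e, p, hp⟩ := LaurentRing.exists_mul_single_eq f
  have h1 := congrArg (laurentEval K x hx) hp
  rw [map_mul, hf, zero_mul, laurentEval_ofMvPolynomial] at h1
  rw [hind.eq_zero_of_aeval_eq_zero _ h1.symm, map_zero] at hp
  exact (LaurentRing.isUnit_single _).mul_left_eq_zero.mp hp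

lemma range_laurentEval (hx : ∀ i, x i ≠ 0) :
    (laurentEval K x hx).range = laurent K x Set.univ := by
  classical
  apply le_antisymm
  · rintro _ ⟨f, rfl⟩
    change laurentEval K x hx f ∈ _
    induction f using AddMonoidAlgebra.induction_linear with
    | zero => rw [map_zero]; exact zero_mem _
    | add f g hf hg => rw [map_add]; exact add_mem hf hg
    | single e r =>
      rw [laurentEval_single]
      exact Subalgebra.smul_mem _ (mon_mem_laurent (by simp)) r
  · refine laurent_le fun i _ => ⟨⟨AddMonoidAlgebra.single (Pi.single i 1) 1, ?_⟩,
      ⟨AddMonoidAlgebra.single (Pi.single i (-1)) 1, ?_⟩⟩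
    · change laurentEval K x hx _ = _
      rw [laurentEval_single, mon_single, one_smul, zpow_one]
    · change laurentEval K x hx _ = _
      rw [laurentEval_single, mon_single, one_smul, zpow_neg, zpow_one]

lemma mem_laurent_univ_iff (hx : ∀ i, x i ≠ 0) {f : F} :
    f ∈ laurent K x Set.univ ↔ ∃ g, laurentEval K x hx g = f := by
  rw [← range_laurentEval hx]; rfl

/-- The ring of Laurent polynomials in an algebraically independent family, as a subring of `F`. -/
noncomputable def laurentEquiv (hx : ∀ i, x i ≠ 0) (hind : AlgebraicIndependent K x) :
    LaurentRing K ι ≃ₐ[K] laurent K x Set.univ :=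
  (AlgEquiv.ofInjective _ (laurentEval_injective hx hind)).trans
    (Subalgebra.equivOfEq _ _ (range_laurentEval hx))

end Laurent

/-! ### Exchange polynomials and the exchange of two variables -/

/-- An integer vector is primitive if its entries have no common divisor besides units. -/
def IsPrimitiveVector {ι : Type*} (β : ι → ℤ) : Prop := ∀ d : ℤ, (∀ i, d ∣ β i) → IsUnit d

lemma IsPrimitiveVector.ne_zero {ι : Type*} {β : ι → ℤ} (h : IsPrimitiveVector β) : β ≠ 0 := by
  rintro rfl
  exact not_isUnit_zero (h 0 fun i => by simp)

lemma IsPrimitiveVector.exists_linearForm {ι : Type*} [Fintype ι] {β : ι → ℤ}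
    (h : IsPrimitiveVector β) : ∃ φ : (ι → ℤ) →+ ℤ, φ β = 1 := by
  obtain ⟨d, hd⟩ := IsPrincipalIdealRing.principal (Ideal.span (Set.range β))
  have hu : IsUnit d := h d fun i => by
    rw [← Ideal.mem_span_singleton]
    change β i ∈ Submodule.span ℤ {d}
    rw [← hd]
    exact Ideal.subset_span ⟨i, rfl⟩
  have h1 : (1 : ℤ) ∈ Ideal.span (Set.range β) := by
    rw [hd]
    exact (Ideal.eq_top_iff_one _).mp (Ideal.span_singleton_eq_top.mpr hu)
  obtain ⟨c, hc⟩ := Ideal.mem_span_range_iff_exists_fun.mp h1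
  refine ⟨∑ i, (AddMonoidHom.mulLeft (c i)).comp (Pi.evalAddMonoidHom (fun _ => ℤ) i), ?_⟩
  simpa using hc

section Exchange

variable {K F ι : Type*} [CommRing K] [Field F] [Algebra K F] [Fintype ι]
  {x x' : ι → F} {T : Set ι} {β γ : ι → ℤ}

/-- The exchange binomial with exponent vector `β`: the sum of the monomials given by the positive
and the negative part of `β`. -/
def exchangePoly (x : ι → F) (β : ι → ℤ) : F := mon x β⁺ + mon x β⁻

lemma exchangePoly_neg : exchangePoly x (-β) = exchangePoly x β := by
  rw [exchangePoly, exchangePoly, posPart_neg, negPart_neg, add_comm]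

lemma exchangePoly_eq (hx : ∀ i, x i ≠ 0) : exchangePoly x β = mon x β⁻ * (1 + mon x β) := by
  rw [mul_add, mul_one, ← mon_add hx, exchangePoly, add_comm]
  congr 2
  rw [add_comm, ← sub_eq_iff_eq_add, posPart_sub_negPart]

lemma exchangePoly_congr (h : ∀ i, β i ≠ 0 → x i = x' i) :
    exchangePoly x β = exchangePoly x' β := by
  rw [exchangePoly, exchangePoly]
  congr 1 <;> refine mon_congr fun i hi => h i fun h0 => hi ?_
  · rw [Pi.posPart_apply, h0, posPart_zero]
  · rw [Pi.negPart_apply, h0, negPart_zero]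

lemma mon_posPart_mem (h : ∀ i ∉ T, β i = 0) : mon x β⁺ ∈ laurent K x T :=
  mon_mem_laurent fun i hi => by rw [Pi.posPart_apply, h i hi, posPart_zero]

lemma mon_negPart_mem (h : ∀ i ∉ T, β i = 0) : mon x β⁻ ∈ laurent K x T :=
  mon_mem_laurent fun i hi => by rw [Pi.negPart_apply, h i hi, negPart_zero]

lemma exchangePoly_mem (h : ∀ i ∉ T, β i = 0) : exchangePoly x β ∈ laurent K x T :=
  add_mem (mon_posPart_mem h) (mon_negPart_mem h)

lemma exchangePoly_mem_univ : exchangePoly x β ∈ laurent K x Set.univ :=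
  exchangePoly_mem (by simp)

/-- Up to a monomial, the exchange binomial with exponent vector `β` is the Laurent binomial
`1 + X ^ β`. -/
lemma exists_associated_exchangePoly (hx : ∀ i, x i ≠ 0) (hind : AlgebraicIndependent K x)
    (β : ι → ℤ) : Associated
      (laurentEquiv hx hind (1 + AddMonoidAlgebra.single β 1))
      (⟨exchangePoly x β, exchangePoly_mem_univ⟩ : laurent K x Set.univ) := by
  have hu := (LaurentRing.isUnit_single (K := K) β⁻).map (laurentEquiv hx hind)
  refine ⟨hu.unit, Subtype.ext ?_⟩
  change laurentEval K x hx _ * laurentEval K x hx _ = _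
  rw [map_add, map_one, laurentEval_single, laurentEval_single, one_smul, one_smul,
    mul_comm]
  exact (exchangePoly_eq hx).symm

lemma prime_exchangePoly [IsDomain K] (hx : ∀ i, x i ≠ 0) (hind : AlgebraicIndependent K x)
    (hβ : IsPrimitiveVector β) :
    Prime (⟨exchangePoly x β, exchangePoly_mem_univ⟩ : laurent K x Set.univ) := by
  obtain ⟨φ, hφ⟩ := hβ.exists_linearForm
  refine (exists_associated_exchangePoly hx hind β).prime ?_
  exact (MulEquiv.prime_iff (laurentEquiv hx hind)).mpr (LaurentRing.prime_binomial hφ)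

lemma exchangePoly_ne_zero [IsDomain K] (hx : ∀ i, x i ≠ 0) (hind : AlgebraicIndependent K x)
    (hβ : IsPrimitiveVector β) : exchangePoly x β ≠ 0 := fun h =>
  (prime_exchangePoly hx hind hβ).ne_zero (Subtype.ext h)

lemma exists_eq_smul_of_exchangePoly_dvd [IsDomain K] (hx : ∀ i, x i ≠ 0)
    (hind : AlgebraicIndependent K x) (hβ : IsPrimitiveVector β)
    (h : (⟨exchangePoly x β, exchangePoly_mem_univ⟩ : laurent K x Set.univ) ∣
      ⟨exchangePoly x γ, exchangePoly_mem_univ⟩) : ∃ c : ℤ, γ = c • β := by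
  obtain ⟨φ, hφ⟩ := hβ.exists_linearForm
  refine LaurentRing.exists_eq_smul_of_binomial_dvd (K := K) hφ ?_
  rw [← map_dvd_iff (laurentEquiv hx hind)]
  exact (exists_associated_exchangePoly hx hind β).dvd.trans
    (h.trans (exists_associated_exchangePoly hx hind γ).symm.dvd)

lemma prime_exchangePoly_compl [IsDomain K] (hx : ∀ i, x i ≠ 0) (hind : AlgebraicIndependent K x)
    (hβ : IsPrimitiveVector β) {k : ι} (hk : ∀ i ∉ ({k}ᶜ : Set ι), β i = 0) :
    Prime (⟨exchangePoly x β, exchangePoly_mem hk⟩ : laurent K x {k}ᶜ) :=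
  prime_laurent_compl hx hind _ _ (prime_exchangePoly hx hind hβ)

variable [DecidableEq ι]

lemma mon_update (hx : ∀ i, x i ≠ 0) (p : ι) (y : F) (e : ι → ℤ) :
    mon (Function.update x p y) e = mon x e * (y / x p) ^ e p := by
  rw [mon, mon, ← Finset.mul_prod_erase _ _ (Finset.mem_univ p),
    ← Finset.mul_prod_erase _ (fun i => x i ^ e i) (Finset.mem_univ p), Function.update_self,
    div_zpow]
  have h : ∏ i ∈ Finset.univ.erase p, Function.update x p y i ^ e i =
      ∏ i ∈ Finset.univ.erase p, x i ^ e i :=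
    Finset.prod_congr rfl fun i hi => by rw [Function.update_of_ne (Finset.ne_of_mem_erase hi)]
  rw [h]
  have := zpow_ne_zero (e p) (hx p)
  field_simp

section Transfer

variable {p k : ι} {βp βk βk' : ι → ℤ} {f : F}

/-- The case of two exchanges that do not interact. -/
lemma mem_laurent_update_update_of_eq_zero [IsDomain K] (hind : AlgebraicIndependent K x)
    (hpk : p ≠ k) (hβp : IsPrimitiveVector βp) (hβk : IsPrimitiveVector βk)
    (hpp : βp p = 0) (hkk : βk k = 0) (hkp : βk p = 0) (hpk' : βp k = 0)
    (hli : ∀ c : ℤ, βp ≠ c • βk)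
    (h1 : f ∈ laurent K x Set.univ)
    (h2 : f ∈ laurent K (Function.update x k (exchangePoly x βk / x k)) Set.univ)
    (h3 : f ∈ laurent K (Function.update x p (exchangePoly x βp / x p)) Set.univ) :
    f ∈ laurent K (Function.update (Function.update x p (exchangePoly x βp / x p)) k
      (exchangePoly (Function.update x p (exchangePoly x βp / x p)) βk / x k)) Set.univ := by
  have hx : ∀ i, x i ≠ 0 := hind.ne_zero
  have hPp := exchangePoly_ne_zero hx hind hβp
  have hPk := exchangePoly_ne_zero hx hind hβk
  have hind' := algebraicIndependent_update hind p (exchangePoly_mem (K := K) (x := x)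
    (T := {p}ᶜ) (β := βp) (by simpa using hpp)) hPp
  set x' := Function.update x p (exchangePoly x βp / x p) with hx'
  have hx'0 : ∀ i, x' i ≠ 0 := hind'.ne_zero
  have hx'k : x' k = x k := Function.update_of_ne hpk.symm _ _
  have hkT : ∀ i ∉ ({k}ᶜ : Set ι), βk i = 0 := by simpa using hkk
  have hpT : ∀ i ∉ ({k}ᶜ : Set ι), βp i = 0 := by simpa using hpk'
  have hcongr : ∀ γ : ι → ℤ, γ p = 0 → exchangePoly x γ = exchangePoly x' γ := fun γ hγ =>
    exchangePoly_congr fun i hi => (Function.update_of_ne (by rintro rfl; exact hi hγ) _ _).symm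
  have hPk' := prime_exchangePoly_compl hx'0 hind' hβk hkT
  rw [mem_laurent_update_iff (div_ne_zero (exchangePoly_ne_zero hx'0 hind' hβk) (hx k))]
  rw [mem_laurent_update_iff (div_ne_zero hPk (hx k))] at h2
  have hPpS : exchangePoly x βp ∈ laurent K x' {k}ᶜ := by
    rw [hcongr βp hpp]; exact exchangePoly_mem hpT
  have hh : aeval (x k) (C ⟨exchangePoly x βp, hPpS⟩ : (laurent K x' {k}ᶜ)[X]) =
      exchangePoly x βp := by rw [aeval_C]; rfl
  refine LaurentOver.exchange_transfer (S := laurent K x {k}ᶜ) (S' := laurent K x' {k}ᶜ)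
    (transcendental_laurent hind (by simp)) (by
      rw [← hx'k]; exact transcendental_laurent hind' (by simp))
    (P := ⟨exchangePoly x βk, exchangePoly_mem hkT⟩) (fun h => hPk (congrArg Subtype.val h))
    hPk' (h := C ⟨exchangePoly x βp, hPpS⟩) ?_
    (exists_pow_mul_eq_aeval hpk hx hPp hh)
    ?_ ((laurentOver_iff (hx k)).mpr h1) h2 ?_
  · rw [coeff_C_zero]
    intro hdvd
    let incl := Subalgebra.inclusion (laurent_mono (K := K) (x := x') (Set.subset_univ {k}ᶜ))
    have hdvd' := map_dvd incl hdvd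
    have e : incl ⟨exchangePoly x βp, hPpS⟩ = ⟨exchangePoly x' βp, exchangePoly_mem_univ⟩ :=
      Subtype.ext (hcongr βp hpp)
    rw [e] at hdvd'
    obtain ⟨c, hc⟩ := exists_eq_smul_of_exchangePoly_dvd (γ := βp) hx'0 hind' hβk hdvd'
    exact hli c hc
  · refine ⟨0, C ⟨exchangePoly x' βk, exchangePoly_mem hkT⟩, ?_, MemPowIdeal.C⟩
    rw [pow_zero, one_mul, aeval_C]
    exact hcongr βk hkp
  · rw [← hx'k]; exact (laurentOver_iff (hx'0 k)).mpr h3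

/-- The case of two exchanges that interact. Modulo `x k`, the exchange binomial at `p` is a
monomial, and the two exchange binomials at `k` agree up to units. -/
lemma mem_laurent_update_update_of_pos [IsDomain K] (hind : AlgebraicIndependent K x)
    (hpk : p ≠ k) (hβp : IsPrimitiveVector βp) (hβk : IsPrimitiveVector βk)
    (hβk' : IsPrimitiveVector βk')
    (hpp : βp p = 0) (hkk : βk k = 0) (hkp : 0 < βk p) (hpk' : βp k < 0)
    (hmut : ∀ i, βk' i = if i = p then -βk p else βk i + βk p * (βp i)⁺)
    (h1 : f ∈ laurent K x Set.univ)
    (h2 : f ∈ laurent K (Function.update x k (exchangePoly x βk / x k)) Set.univ)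
    (h3 : f ∈ laurent K (Function.update x p (exchangePoly x βp / x p)) Set.univ) :
    f ∈ laurent K (Function.update (Function.update x p (exchangePoly x βp / x p)) k
      (exchangePoly (Function.update x p (exchangePoly x βp / x p)) βk' / x k)) Set.univ := by
  have hx : ∀ i, x i ≠ 0 := hind.ne_zero
  have hPp := exchangePoly_ne_zero hx hind hβp
  have hPk := exchangePoly_ne_zero hx hind hβk
  have hind' := algebraicIndependent_update hind p (exchangePoly_mem (K := K) (x := x)
    (T := {p}ᶜ) (β := βp) (by simpa using hpp)) hPp
  set x' := Function.update x p (exchangePoly x βp / x p) with hx'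
  have hx'0 : ∀ i, x' i ≠ 0 := hind'.ne_zero
  have hx'k : x' k = x k := Function.update_of_ne hpk.symm _ _
  have hkk' : βk' k = 0 := by
    rw [hmut, if_neg hpk.symm, hkk, posPart_of_nonpos hpk'.le, mul_zero, add_zero]
  have hkT : ∀ i ∉ ({k}ᶜ : Set ι), βk i = 0 := by simpa using hkk
  have hkT' : ∀ i ∉ ({k}ᶜ : Set ι), βk' i = 0 := by simpa using hkk'
  have hPk' := prime_exchangePoly_compl hx'0 hind' hβk' hkT'
  rw [mem_laurent_update_iff (div_ne_zero (exchangePoly_ne_zero hx'0 hind' hβk') (hx k))]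
  rw [mem_laurent_update_iff (div_ne_zero hPk (hx k))] at h2
  set S' := laurent K x' {k}ᶜ with hS'
  obtain ⟨c, hc⟩ := Int.eq_ofNat_of_zero_le hkp.le
  obtain ⟨d, hd⟩ := Int.eq_ofNat_of_zero_le (neg_pos.mpr hpk').le
  -- A monomial that involves neither `x p` nor `x k` is a unit of the coefficient ring `S'`.
  have hmonS' : ∀ e : ι → ℤ, e p = 0 → e k = 0 → mon x e ∈ S' := fun e hep hek => by
    rw [mon_congr (x' := x') fun i hi =>
      (Function.update_of_ne (by rintro rfl; exact hi hep) _ _).symm]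
    exact mon_mem_laurent (by simpa using hek)
  have hpos_p : βp⁺ p = 0 := by rw [Pi.posPart_apply, hpp, posPart_zero]
  have hpos_k : βp⁺ k = 0 := by rw [Pi.posPart_apply, posPart_of_nonpos hpk'.le]
  set u : F := mon x βp⁺ with hu
  have hu0 : u ≠ 0 := mon_ne_zero hx _
  have huS : u ∈ S' := hmonS' _ hpos_p hpos_k
  have huS' : u⁻¹ ∈ S' := by
    rw [hu, ← mon_neg]
    exact hmonS' _ (by rw [Pi.neg_apply, hpos_p, neg_zero]) (by rw [Pi.neg_apply, hpos_k, neg_zero])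
  set v : F := mon x (Function.update βp⁻ k 0) with hv
  have hvS : v ∈ S' := hmonS' _
    (by rw [Function.update_of_ne hpk, Pi.negPart_apply, hpp, negPart_zero]) (by simp)
  have hPp_eq : exchangePoly x βp = u + v * x k ^ d := by
    rw [exchangePoly, ← hu]
    congr 1
    rw [hv, ← zpow_natCast, ← hd, ← mon_single (x := x) k, ← mon_add hx]
    congr 1
    ext i
    by_cases hik : i = k
    · subst hik
      simp [negPart_of_nonpos hpk'.le]
    · simp [hik]
  have hd0 : d ≠ 0 := by rintro rfl; simp at hd; omega
  set h : S'[X] := C ⟨u, huS⟩ + C ⟨v, hvS⟩ * X ^ d with hh_def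
  have hh : aeval (x k) h = exchangePoly x βp := by
    rw [hPp_eq, hh_def, map_add, map_mul, map_pow, aeval_X, aeval_C, aeval_C]; rfl
  have hh0 : h.coeff 0 = ⟨u, huS⟩ := by
    rw [hh_def, coeff_add, coeff_C_zero, coeff_C_mul, coeff_X_pow, if_neg hd0.symm, mul_zero,
      add_zero]
  -- The transformation rule for the ratio of the two monomials in the exchange relation at `k`.
  have hy : mon x' βk' = mon x βk * (u / exchangePoly x βp) ^ c := by
    have e1 : βk' = βk + (c : ℤ) • βp⁺ + (-2 * (c : ℤ)) • Pi.single p 1 := by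
      ext i
      rw [hmut, Pi.add_apply, Pi.add_apply, Pi.smul_apply, Pi.smul_apply, Pi.posPart_apply]
      split_ifs with hi
      · subst hi
        rw [hpp, posPart_zero, Pi.single_eq_same, hc]
        simp
        ring
      · rw [Pi.single_eq_of_ne hi, hc]
        simp
    rw [hx', mon_update hx, hmut p, if_pos rfl, e1, mon_add hx, mon_add hx, mon_smul, mon_smul,
      mon_single, zpow_one, ← hu, hc, zpow_neg, zpow_natCast, zpow_natCast, neg_mul, zpow_neg,
      zpow_mul, zpow_natCast]
    have := hx p
    have e2 : (x p : F) ^ (2 : ℤ) = x p ^ 2 := by norm_cast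
    rw [e2]
    simp only [div_pow]
    field_simp
    ring
  set m : F := mon x βk⁻ with hm
  have hmS : m ∈ S' := hmonS' _
    (by rw [Pi.negPart_apply, negPart_of_nonneg hkp.le])
    (by rw [Pi.negPart_apply, hkk, negPart_zero])
  have hm' : (mon x' βk'⁻)⁻¹ ∈ S' := by
    rw [← mon_neg]
    exact mon_mem_laurent fun i hi => by
      rw [Pi.neg_apply, Pi.negPart_apply, hkT' i hi, negPart_zero, neg_zero]
  refine LaurentOver.exchange_transfer (S := laurent K x {k}ᶜ) (S' := S')
    (transcendental_laurent hind (by simp)) (by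
      rw [← hx'k]; exact transcendental_laurent hind' (by simp))
    (P := ⟨exchangePoly x βk, exchangePoly_mem hkT⟩) (fun h => hPk (congrArg Subtype.val h))
    hPk' (h := h) ?_ (exists_pow_mul_eq_aeval hpk hx hPp hh)
    ?_ ((laurentOver_iff (hx k)).mpr h1) h2 ?_
  · rw [hh0]
    intro hdvd
    refine hPk'.not_isUnit (isUnit_of_dvd_unit hdvd ?_)
    exact IsUnit.of_mul_eq_one ⟨u⁻¹, huS'⟩ (Subtype.ext (mul_inv_cancel₀ hu0))
  · refine ⟨0, C (⟨m, hmS⟩ * ⟨u⁻¹, huS'⟩ ^ c) * (h ^ c * C ⟨_, hm'⟩ *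
      C ⟨exchangePoly x' βk', exchangePoly_mem hkT'⟩ + (C ⟨u, huS⟩ ^ c - h ^ c)), ?_, ?_⟩
    · rw [pow_zero, one_mul]
      simp only [map_mul, map_add, map_sub, map_pow, hh, aeval_C]
      change _ = m * u⁻¹ ^ c * (exchangePoly x βp ^ c * (mon x' βk'⁻)⁻¹ * exchangePoly x' βk' +
        (u ^ c - exchangePoly x βp ^ c))
      rw [exchangePoly_eq hx'0, hy]
      rw [exchangePoly_eq hx, ← hm]
      have := mon_ne_zero hx'0 βk'⁻
      have huc : u ^ c * u⁻¹ ^ c = 1 := by rw [← mul_pow, mul_inv_cancel₀ hu0, one_pow]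
      simp only [div_pow]
      field_simp
      linear_combination (-m - m * mon x βk) * huc
    · have hlow : MemPowIdeal (⟨exchangePoly x' βk', exchangePoly_mem hkT'⟩ : S') 1
          (C ⟨u, huS⟩ ^ c - h ^ c) := by
        intro i
        rcases i with _ | i
        · rw [coeff_sub, coeff_zero_eq_eval_zero, coeff_zero_eq_eval_zero, eval_pow, eval_pow,
            ← coeff_zero_eq_eval_zero, ← coeff_zero_eq_eval_zero, hh0, coeff_C_zero, sub_self]
          exact dvd_zero _
        · simp
      have e1 := ((MemPowIdeal.of_zero (P := (⟨exchangePoly x' βk', exchangePoly_mem hkT'⟩ : S'))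
        (h ^ c * C ⟨_, hm'⟩)).mul MemPowIdeal.C).add (by rwa [zero_add])
      have e2 := (MemPowIdeal.of_zero (P := (⟨exchangePoly x' βk', exchangePoly_mem hkT'⟩ : S'))
        (C (⟨m, hmS⟩ * ⟨u⁻¹, huS'⟩ ^ c))).mul e1
      simpa using e2
  · rw [← hx'k]; exact (laurentOver_iff (hx'0 k)).mpr h3

/-- A Laurent polynomial in the clusters `x`, `μ_k x` and `μ_p x` is one in `μ_k μ_p x`. Here `βp`
and `βk` are the exponent vectors of the exchange relations of `x` at `p` and `k`, and `βk'` is the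
one of `μ_p x` at `k`. -/
lemma mem_laurent_update_update [IsDomain K] (hind : AlgebraicIndependent K x)
    (hpk : p ≠ k) (hβp : IsPrimitiveVector βp) (hβk : IsPrimitiveVector βk)
    (hβk' : IsPrimitiveVector βk')
    (hpp : βp p = 0) (hkk : βk k = 0) (hsign : (βp k).sign = -(βk p).sign)
    (hli : ∀ c : ℤ, βp ≠ c • βk)
    (hmut : ∀ i, βk' i = if i = p then -βk p else βk i + (βp i).sign * max (βp i * βk p) 0)
    (h1 : f ∈ laurent K x Set.univ)
    (h2 : f ∈ laurent K (Function.update x k (exchangePoly x βk / x k)) Set.univ)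
    (h3 : f ∈ laurent K (Function.update x p (exchangePoly x βp / x p)) Set.univ) :
    f ∈ laurent K (Function.update (Function.update x p (exchangePoly x βp / x p)) k
      (exchangePoly (Function.update x p (exchangePoly x βp / x p)) βk' / x k)) Set.univ := by
  have hsgn : ∀ a b : ℤ, 0 < b → a.sign * max (a * b) 0 = b * a⁺ := fun a b hb => by
    rcases lt_trichotomy a 0 with ha | rfl | ha
    · rw [max_eq_right (by nlinarith), posPart_of_nonpos ha.le]; simp
    · simp
    · rw [max_eq_left (by positivity), posPart_of_nonneg ha.le, Int.sign_eq_one_of_pos ha]; ring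
  have hneg : ∀ {γ : ι → ℤ}, IsPrimitiveVector γ → IsPrimitiveVector (-γ) := fun hγ d hd =>
    hγ d fun i => (dvd_neg).mp (hd i)
  rcases lt_trichotomy (βk p) 0 with h | h | h
  · rw [← exchangePoly_neg (β := βp)] at h3 ⊢
    rw [← exchangePoly_neg (β := βk)] at h2
    rw [← exchangePoly_neg (β := βk')]
    rw [Int.sign_eq_neg_one_of_neg h, neg_neg, Int.sign_eq_one_iff_pos] at hsign
    refine mem_laurent_update_update_of_pos hind hpk (hneg hβp) (hneg hβk) (hneg hβk')
      (by simpa using hpp) (by simpa using hkk) (by simpa using h) (by simpa using hsign)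
      (fun i => ?_) h1 h2 h3
    have h4 := hsgn (-βp i) (-βk p) (by omega)
    rw [Int.sign_neg, neg_mul_neg] at h4
    simp only [Pi.neg_apply, hmut i]
    split_ifs
    · rfl
    · rw [← h4]; ring
  · have hβ : βk' = βk := by
      ext i
      rw [hmut, h]
      split_ifs with hi
      · rw [hi, h, neg_zero]
      · simp
    rw [hβ]
    rw [h, Int.sign_zero, neg_zero, Int.sign_eq_zero_iff_zero] at hsign
    exact mem_laurent_update_update_of_eq_zero hind hpk hβp hβk hpp hkk h hsign hli h1 h2 h3
  · rw [Int.sign_eq_one_of_pos h, Int.sign_eq_neg_one_iff_neg] at hsign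
    refine mem_laurent_update_update_of_pos hind hpk hβp hβk hβk' hpp hkk h hsign
      (fun i => ?_) h1 h2 h3
    rw [hmut, hsgn _ _ h]

end Transfer

end Exchange

/-! ### Gluing rings along prime elements -/

/-- A subring `U` of a field `F` is the intersection of a subring `D₀` and a family of subrings
`D k`, where `a k` is a prime element of `D k` defining a discrete valuation there, and is a unit of
`D₀` and of `D j` for `j ≠ k`. Divisibility of `f` by `a k` in `D k` is expressed as
`f / a k ∈ D k`. For the upper cluster algebra, `D₀` and `D k` are the Laurent polynomial rings of a
seed and of its neighbours, and the `a k` are the cluster variables of the seed. -/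
structure IsPrimeGluing {R F κ : Type*} [CommRing R] [Field F] [Algebra R F]
    (U D₀ : Subalgebra R F) (D : κ → Subalgebra R F) (a : κ → F) : Prop where
  mem_iff : ∀ f, f ∈ U ↔ f ∈ D₀ ∧ ∀ k, f ∈ D k
  ne_zero : ∀ k, a k ≠ 0
  mem₀ : ∀ k, a k ∈ D₀
  inv_mem₀ : ∀ k, (a k)⁻¹ ∈ D₀
  mem : ∀ j k, a k ∈ D j
  inv_mem : ∀ j k, j ≠ k → (a k)⁻¹ ∈ D j
  inv_notMem : ∀ k, (a k)⁻¹ ∉ D k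
  prime : ∀ k, ∀ f ∈ D k, ∀ g ∈ D k, f * g / a k ∈ D k → f / a k ∈ D k ∨ g / a k ∈ D k
  exists_pow_mul_mem : ∀ k, ∀ f ∈ D₀, ∃ N : ℕ, a k ^ N * f ∈ D k
  exists_div_pow_notMem : ∀ k, ∀ f ∈ D k, f ≠ 0 → ∃ N : ℕ, f / a k ^ N ∉ D k

namespace IsPrimeGluing

variable {R F κ : Type*} [CommRing R] [Field F] [Algebra R F]
  {U D₀ : Subalgebra R F} {D : κ → Subalgebra R F} {a : κ → F} {f g p c : F}

variable (U D a) in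
/-- An element of `U` which, for every `k`, is not divisible by `a k` in `D k`. -/
def Pure (g : F) : Prop := g ∈ U ∧ ∀ k, g / a k ∉ D k

section

variable (h : IsPrimeGluing U D₀ D a)
include h

lemma zpow_mem₀ (k : κ) (n : ℤ) : a k ^ n ∈ D₀ := by
  rcases n with n | n
  · simpa using pow_mem (h.mem₀ k) n
  · rw [zpow_negSucc, ← inv_pow]
    exact pow_mem (h.inv_mem₀ k) _

lemma zpow_mem {j k : κ} (hjk : j ≠ k) (n : ℤ) : a k ^ n ∈ D j := by
  rcases n with n | n
  · simpa using pow_mem (h.mem j k) n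
  · rw [zpow_negSucc, ← inv_pow]
    exact pow_mem (h.inv_mem j k hjk) _

lemma a_mem (k : κ) : a k ∈ U := (h.mem_iff _).mpr ⟨h.mem₀ k, fun j => h.mem j k⟩

lemma le₀ (hf : f ∈ U) : f ∈ D₀ := ((h.mem_iff f).mp hf).1

lemma le (hf : f ∈ U) (k : κ) : f ∈ D k := ((h.mem_iff f).mp hf).2 k

lemma pure_mul (hf : Pure U D a f) (hg : Pure U D a g) : Pure U D a (f * g) :=
  ⟨mul_mem hf.1 hg.1, fun k hk =>
    (h.prime k f (h.le hf.1 k) g (h.le hg.1 k) hk).elim (hf.2 k) (hg.2 k)⟩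

/-- A pure element that divides an element of `U` in `D₀` divides it in `U`. -/
lemma mem_of_pure_mul_mem (hp : Pure U D a p) (hc : c ∈ D₀) (hpc : p * c ∈ U) : c ∈ U := by
  refine (h.mem_iff c).mpr ⟨hc, fun k => ?_⟩
  have hN := h.exists_pow_mul_mem k c hc
  have hak := h.ne_zero k
  classical
  rcases hn : Nat.find hN with _ | n
  · have := Nat.find_spec hN
    rwa [hn, pow_zero, one_mul] at this
  · have hspec := Nat.find_spec hN
    rw [hn] at hspec
    have hmin := Nat.find_min hN (m := n) (by omega)
    refine absurd (h.prime k _ hspec p (h.le hp.1 k) ?_) (not_or.mpr ⟨?_, hp.2 k⟩)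
    · have e : a k ^ (n + 1) * c * p / a k = a k ^ n * (p * c) := by
        rw [pow_succ]; field_simp
      rw [e]
      exact mul_mem (pow_mem (h.mem k k) n) (h.le hpc k)
    · have e : a k ^ (n + 1) * c / a k = a k ^ n * c := by
        rw [pow_succ]; field_simp
      rwa [e]

lemma prime_a (k : κ) : Prime (⟨a k, h.a_mem k⟩ : U) := by
  have hmem : ∀ f ∈ U, f / a k ∈ D k → f / a k ∈ U := fun f hf hfk => by
    refine (h.mem_iff _).mpr ⟨?_, fun j => ?_⟩
    · rw [div_eq_mul_inv]; exact mul_mem (h.le₀ hf) (h.inv_mem₀ k)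
    · by_cases hj : j = k
      · rwa [hj]
      · rw [div_eq_mul_inv]; exact mul_mem (h.le hf j) (h.inv_mem j k hj)
  refine ⟨fun h0 => h.ne_zero k (congrArg Subtype.val h0), fun hu => ?_, ?_⟩
  · obtain ⟨⟨g, hg⟩, hag⟩ := hu.exists_right_inv
    have hag' : a k * g = 1 := congrArg Subtype.val hag
    refine h.inv_notMem k ?_
    rw [← eq_inv_of_mul_eq_one_right hag']
    exact h.le hg k
  · rintro ⟨f, hf⟩ ⟨g, hg⟩ ⟨⟨c, hc⟩, hfg⟩
    have hfg' : f * g = a k * c := congrArg Subtype.val hfg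
    have h1 : f * g / a k ∈ D k := by
      rw [hfg', mul_div_cancel_left₀ _ (h.ne_zero k)]
      exact h.le hc k
    refine (h.prime k f (h.le hf k) g (h.le hg k) h1).imp (fun h2 => ?_) (fun h2 => ?_)
    · exact ⟨⟨_, hmem f hf h2⟩, Subtype.ext (mul_div_cancel₀ f (h.ne_zero k)).symm⟩
    · exact ⟨⟨_, hmem g hg h2⟩, Subtype.ext (mul_div_cancel₀ g (h.ne_zero k)).symm⟩

lemma prime_of_pure (hp : Pure U D a p) (hp₀ : Prime (⟨p, h.le₀ hp.1⟩ : D₀)) :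
    Prime (⟨p, hp.1⟩ : U) := by
  have hp0 : p ≠ 0 := fun h0 => hp₀.ne_zero (Subtype.ext h0)
  refine ⟨fun h0 => hp0 (congrArg Subtype.val h0), fun hu => ?_, ?_⟩
  · obtain ⟨⟨g, hg⟩, hpg⟩ := hu.exists_right_inv
    have hpg' : p * g = 1 := congrArg Subtype.val hpg
    exact hp₀.not_isUnit (IsUnit.of_mul_eq_one ⟨g, h.le₀ hg⟩ (Subtype.ext hpg'))
  · rintro ⟨f, hf⟩ ⟨g, hg⟩ ⟨⟨c, hc⟩, hfg⟩
    have hfg' : f * g = p * c := congrArg Subtype.val hfg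
    refine (hp₀.dvd_or_dvd (a := ⟨f, h.le₀ hf⟩) (b := ⟨g, h.le₀ hg⟩)
      ⟨⟨c, h.le₀ hc⟩, Subtype.ext hfg'⟩).imp ?_ ?_
    · rintro ⟨⟨d, hd⟩, hfd⟩
      have hfd' : f = p * d := congrArg Subtype.val hfd
      exact ⟨⟨d, h.mem_of_pure_mul_mem hp hd (hfd' ▸ hf)⟩, Subtype.ext hfd'⟩
    · rintro ⟨⟨d, hd⟩, hfd⟩
      have hfd' : g = p * d := congrArg Subtype.val hfd
      exact ⟨⟨d, h.mem_of_pure_mul_mem hp hd (hfd' ▸ hg)⟩, Subtype.ext hfd'⟩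

variable [Fintype κ]

lemma prod_zpow_mem₀ (e : κ → ℤ) : ∏ k, a k ^ e k ∈ D₀ := prod_mem fun k _ => h.zpow_mem₀ k _

lemma prod_erase_zpow_mem [DecidableEq κ] (k : κ) (e : κ → ℤ) :
    ∏ j ∈ Finset.univ.erase k, a j ^ e j ∈ D k :=
  prod_mem fun _ hj => h.zpow_mem (Finset.ne_of_mem_erase hj).symm _

/-- Every nonzero element of `D₀` is a pure element of `U` up to a monomial in the `a k`. -/
lemma exists_pure_mul_prod [DecidableEq κ] (hf : f ∈ D₀) (hf0 : f ≠ 0) :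
    ∃ (g : F) (e : κ → ℤ), Pure U D a g ∧ f = g * ∏ k, a k ^ e k := by
  have hs : ∀ k, ∃ s : ℤ, f * a k ^ s ∈ D k ∧ f * a k ^ s / a k ∉ D k := fun k => by
    have hak := h.ne_zero k
    obtain ⟨N, hN⟩ := h.exists_pow_mul_mem k f hf
    have hM := h.exists_div_pow_notMem k _ hN (mul_ne_zero (pow_ne_zero _ hak) hf0)
    classical
    rcases hm : Nat.find hM with _ | m
    · have := Nat.find_spec hM
      rw [hm, pow_zero, div_one] at this
      exact absurd hN this
    · have hspec := Nat.find_spec hM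
      rw [hm] at hspec
      have hmin := Nat.find_min hM (m := m) (by omega)
      rw [not_not] at hmin
      have e : f * a k ^ ((N : ℤ) - m) = a k ^ N * f / a k ^ m := by
        rw [zpow_sub₀ hak, zpow_natCast, zpow_natCast]; field_simp
      refine ⟨(N : ℤ) - m, ?_, ?_⟩
      · rwa [e]
      · rw [e, div_div, ← pow_succ]; exact hspec
  choose s hs1 hs2 using hs
  have hfac : ∀ k, f * ∏ j, a j ^ s j = f * a k ^ s k * ∏ j ∈ Finset.univ.erase k, a j ^ s j :=
    fun k => by rw [← Finset.mul_prod_erase _ _ (Finset.mem_univ k), mul_assoc]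
  refine ⟨f * ∏ k, a k ^ s k, fun k => -s k, ⟨(h.mem_iff _).mpr ⟨?_, fun k => ?_⟩, fun k hk => ?_⟩,
    ?_⟩
  · exact mul_mem hf (h.prod_zpow_mem₀ s)
  · rw [hfac k]
    exact mul_mem (hs1 k) (h.prod_erase_zpow_mem k s)
  · refine hs2 k ?_
    have h1 := mul_mem hk (h.prod_erase_zpow_mem k fun j => -s j)
    rw [hfac k] at h1
    convert h1 using 1
    have h2 : (∏ j ∈ Finset.univ.erase k, a j ^ s j) *
        ∏ j ∈ Finset.univ.erase k, a j ^ (-s j) = 1 := by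
      rw [← Finset.prod_mul_distrib]
      exact Finset.prod_eq_one fun j _ => by
        rw [← zpow_add₀ (h.ne_zero j), add_neg_cancel, zpow_zero]
    rw [div_mul_eq_mul_div, mul_assoc, h2, mul_one]
  · rw [mul_assoc, ← Finset.prod_mul_distrib, Finset.prod_eq_one, mul_one]
    intro k _
    rw [← zpow_add₀ (h.ne_zero k), add_neg_cancel, zpow_zero]

lemma exponent_nonneg [DecidableEq κ] (hg : Pure U D a g) {e : κ → ℤ}
    (hf : g * ∏ k, a k ^ e k ∈ U) (k : κ) : 0 ≤ e k := by
  by_contra! hk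
  refine hg.2 k ?_
  have h1 := mul_mem (mul_mem (h.le hf k) (h.prod_erase_zpow_mem k fun j => -e j))
    (pow_mem (h.mem k k) (-e k - 1).toNat)
  convert h1 using 1
  have hak := h.ne_zero k
  rw [← Finset.mul_prod_erase _ _ (Finset.mem_univ k)]
  have h2 : (∏ j ∈ Finset.univ.erase k, a j ^ e j) *
      ∏ j ∈ Finset.univ.erase k, a j ^ (-e j) = 1 := by
    rw [← Finset.prod_mul_distrib]
    exact Finset.prod_eq_one fun j _ => by
      rw [← zpow_add₀ (h.ne_zero j), add_neg_cancel, zpow_zero]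
  have h3 : a k ^ e k * a k ^ (-e k - 1).toNat = (a k)⁻¹ := by
    rw [← zpow_natCast, ← zpow_add₀ hak, Int.toNat_of_nonneg (by omega), ← zpow_neg_one]
    congr 1
    ring
  rw [div_eq_mul_inv, ← h3]
  linear_combination (-(g * a k ^ e k * a k ^ (-e k - 1).toNat)) * h2

/-- Factoriality descends from `D₀` to `U`: the primes of `U` are the `a k` and the pure primes
of `D₀`. -/
theorem uniqueFactorizationMonoid [UniqueFactorizationMonoid D₀] :
    UniqueFactorizationMonoid U := by
  classical
  have key : ∀ x : D₀, x ≠ 0 → ∃ (g : F) (hg : Pure U D a g) (e : κ → ℤ) (s : Multiset U),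
      (x : F) = g * ∏ k, a k ^ e k ∧ (∀ q ∈ s, Prime q) ∧ Associated s.prod ⟨g, hg.1⟩ := by
    intro x
    induction x using UniqueFactorizationMonoid.induction_on_prime with
    | h₁ => exact fun h0 => absurd rfl h0
    | h₂ x hx =>
      intro hx0
      obtain ⟨y, hxy⟩ := hx.exists_right_inv
      have hxy' : (x : F) * y = 1 := congrArg Subtype.val hxy
      obtain ⟨g, e, hg, hge⟩ := h.exists_pure_mul_prod x.2 (by simpa using hx0)
      refine ⟨g, hg, e, 0, hge, by simp, ?_⟩
      rw [Multiset.prod_zero, Associated.comm, associated_one_iff_isUnit]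
      have h1 : g * ((∏ k, a k ^ e k) * y) = 1 := by rw [← mul_assoc, ← hge, hxy']
      have h2 : (∏ k, a k ^ e k) * (y : F) ∈ U :=
        h.mem_of_pure_mul_mem hg (mul_mem (h.prod_zpow_mem₀ e) y.2) (by rw [h1]; exact one_mem _)
      exact IsUnit.of_mul_eq_one ⟨_, h2⟩ (Subtype.ext h1)
    | h₃ x q hx0 hq ih =>
      intro _
      obtain ⟨g, hg, e, s, hge, hs, hsg⟩ := ih hx0
      obtain ⟨q', e', hq', hqe⟩ := h.exists_pure_mul_prod q.2 (by simpa using hq.ne_zero)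
      have hass : Associated q ⟨q', h.le₀ hq'.1⟩ := by
        have h1 : ((∏ k, a k ^ e' k) * ∏ k, a k ^ (-e' k)) = 1 := by
          rw [← Finset.prod_mul_distrib]
          exact Finset.prod_eq_one fun j _ => by
            rw [← zpow_add₀ (h.ne_zero j), add_neg_cancel, zpow_zero]
        refine Associated.symm ⟨⟨⟨_, h.prod_zpow_mem₀ e'⟩, ⟨_, h.prod_zpow_mem₀ fun k => -e' k⟩,
          Subtype.ext h1, Subtype.ext ((mul_comm _ _).trans h1)⟩, Subtype.ext hqe.symm⟩
      refine ⟨q' * g, h.pure_mul hq' hg, fun k => e' k + e k, ⟨q', hq'.1⟩ ::ₘ s, ?_, ?_, ?_⟩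
      · have h1 : ∏ k, a k ^ (e' k + e k) = (∏ k, a k ^ e' k) * ∏ k, a k ^ e k := by
          rw [← Finset.prod_mul_distrib]
          exact Finset.prod_congr rfl fun k _ => zpow_add₀ (h.ne_zero k) _ _
        rw [h1]
        change (q : F) * x = _
        rw [hqe, hge]; ring
      · intro r hr
        rcases Multiset.mem_cons.mp hr with rfl | hr
        · exact h.prime_of_pure hq' (hass.prime hq)
        · exact hs r hr
      · rw [Multiset.prod_cons]
        exact (Associated.refl (⟨q', hq'.1⟩ : U)).mul_mul hsg
  refine UniqueFactorizationMonoid.of_exists_prime_factors fun f hf => ?_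
  obtain ⟨g, hg, e, s, hge, hs, hsg⟩ := key ⟨f, h.le₀ f.2⟩ fun h0 => by
    have h0' : (f : F) = 0 := congrArg Subtype.val h0
    exact hf (Subtype.ext h0')
  have hge' : (f : F) = g * ∏ k, a k ^ e k := hge
  have he : ∀ k, 0 ≤ e k := h.exponent_nonneg hg (hge' ▸ f.2)
  refine ⟨s + ∑ k, Multiset.replicate (e k).toNat ⟨a k, h.a_mem k⟩, fun q hq => ?_, ?_⟩
  · rcases Multiset.mem_add.mp hq with hq | hq
    · exact hs q hq
    · obtain ⟨k, -, hk⟩ := Multiset.mem_sum.mp hq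
      rw [Multiset.eq_of_mem_replicate hk]
      exact h.prime_a k
  · rw [Multiset.prod_add, Multiset.prod_sum]
    simp only [Multiset.prod_replicate]
    have h1 : f = ⟨g, hg.1⟩ * ∏ k, (⟨a k, h.a_mem k⟩ : U) ^ (e k).toNat := by
      refine Subtype.ext ?_
      rw [hge']
      push_cast
      congr 1
      exact Finset.prod_congr rfl fun k _ => by rw [← zpow_natCast, Int.toNat_of_nonneg (he k)]
    rw [h1]
    exact hsg.mul_right _

end

section

variable (h : IsPrimeGluing U D₀ D a)
include h

/-- A prime element of `U` is associated to some `a k` or remains prime in `D₀`. -/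
lemma prime_cases [Fintype κ] {M : F} (hM : M ∈ U) (hprime : Prime (⟨M, hM⟩ : U)) :
    (∃ k, ∃ u : U, IsUnit u ∧ M = u * a k) ∨ Prime (⟨M, h.le₀ hM⟩ : D₀) := by
  classical
  by_cases hpure : Pure U D a M
  · right
    have hM0 : M ≠ 0 := fun h0 => hprime.ne_zero (Subtype.ext h0)
    have hup : ∀ f ∈ D₀, ∃ e : κ → ℤ, f * ∏ k, a k ^ e k ∈ U := fun f hf => by
      by_cases hf0 : f = 0
      · exact ⟨0, by simp [hf0]⟩
      obtain ⟨g, e, hg, hge⟩ := h.exists_pure_mul_prod hf hf0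
      refine ⟨fun k => -e k, ?_⟩
      rw [hge, mul_assoc, ← Finset.prod_mul_distrib, Finset.prod_eq_one, mul_one]
      · exact hg.1
      · intro k _
        rw [← zpow_add₀ (h.ne_zero k), add_neg_cancel, zpow_zero]
    have hdown : ∀ f : D₀, ∀ e : κ → ℤ, ∀ c ∈ U, (f : F) * ∏ k, a k ^ e k = M * c →
        (⟨M, h.le₀ hM⟩ : D₀) ∣ f := fun f e c hc hfc => by
      refine ⟨⟨c * ∏ k, a k ^ (-e k), mul_mem (h.le₀ hc) (h.prod_zpow_mem₀ fun k => -e k)⟩,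
        Subtype.ext ?_⟩
      change (f : F) = M * (c * ∏ k, a k ^ (-e k))
      have h1 : (∏ k, a k ^ e k) * ∏ k, a k ^ (-e k) = 1 := by
        rw [← Finset.prod_mul_distrib]
        exact Finset.prod_eq_one fun j _ => by
          rw [← zpow_add₀ (h.ne_zero j), add_neg_cancel, zpow_zero]
      rw [← mul_assoc, ← hfc, mul_assoc, h1, mul_one]
    refine ⟨fun h0 => hM0 (congrArg Subtype.val h0), fun hu => ?_, fun f g hfg => ?_⟩
    · obtain ⟨⟨c, hc⟩, hMc⟩ := hu.exists_right_inv
      have hMc' : M * c = 1 := congrArg Subtype.val hMc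
      have hcU : c ∈ U := h.mem_of_pure_mul_mem hpure hc (by rw [hMc']; exact one_mem _)
      exact hprime.not_isUnit (IsUnit.of_mul_eq_one ⟨c, hcU⟩ (Subtype.ext hMc'))
    · obtain ⟨⟨c, hc⟩, hfgc⟩ := hfg
      have hfgc' : (f : F) * g = M * c := congrArg Subtype.val hfgc
      obtain ⟨e, he⟩ := hup f f.2
      obtain ⟨e', he'⟩ := hup g g.2
      have h1 : M * (c * ((∏ k, a k ^ e k) * ∏ k, a k ^ e' k)) ∈ U := by
        have := mul_mem he he'
        convert this using 1
        linear_combination (-((∏ k, a k ^ e k) * ∏ k, a k ^ e' k)) * hfgc'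
      have h2 := h.mem_of_pure_mul_mem hpure
        (mul_mem hc (mul_mem (h.prod_zpow_mem₀ e) (h.prod_zpow_mem₀ e'))) h1
      refine (hprime.dvd_or_dvd (a := ⟨_, he⟩) (b := ⟨_, he'⟩) ⟨⟨_, h2⟩, Subtype.ext ?_⟩).imp ?_ ?_
      · change (f : F) * (∏ k, a k ^ e k) * (g * ∏ k, a k ^ e' k) =
          M * (c * ((∏ k, a k ^ e k) * ∏ k, a k ^ e' k))
        linear_combination ((∏ k, a k ^ e k) * ∏ k, a k ^ e' k) * hfgc'
      · rintro ⟨⟨d, hd⟩, hfd⟩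
        exact hdown f e d hd (congrArg Subtype.val hfd)
      · rintro ⟨⟨d, hd⟩, hfd⟩
        exact hdown g e' d hd (congrArg Subtype.val hfd)
  · left
    rw [Pure, not_and] at hpure
    have h1 := hpure hM
    push Not at h1
    obtain ⟨k, hk⟩ := h1
    have hmem : M / a k ∈ U := by
      refine (h.mem_iff _).mpr ⟨?_, fun j => ?_⟩
      · rw [div_eq_mul_inv]; exact mul_mem (h.le₀ hM) (h.inv_mem₀ k)
      · by_cases hj : j = k
        · rwa [hj]
        · rw [div_eq_mul_inv]; exact mul_mem (h.le hM j) (h.inv_mem j k hj)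
    have hfac : (⟨M, hM⟩ : U) = ⟨M / a k, hmem⟩ * ⟨a k, h.a_mem k⟩ :=
      Subtype.ext (div_mul_cancel₀ M (h.ne_zero k)).symm
    refine ⟨k, ⟨M / a k, hmem⟩, ?_, (div_mul_cancel₀ M (h.ne_zero k)).symm⟩
    exact (hprime.irreducible.isUnit_or_isUnit hfac).resolve_right (h.prime_a k).not_isUnit

end

end IsPrimeGluing

/-! ### Mutation of the extended cluster -/

namespace Trop

variable {m : ℕ}

@[simp] lemma exponent_mul (x y : Trop m) (i : Fin m) :
    (x * y).exponent i = x.exponent i + y.exponent i := rfl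

@[simp] lemma exponent_inv (x : Trop m) (i : Fin m) : x⁻¹.exponent i = -x.exponent i := rfl

@[simp] lemma exponent_one (i : Fin m) : (1 : Trop m).exponent i = 0 := rfl

@[simp] lemma exponent_zpow (x : Trop m) (a : ℤ) (i : Fin m) :
    (x ^ a).exponent i = a * x.exponent i := by
  rw [exponent, toAdd_zpow, Pi.smul_apply, smul_eq_mul, exponent]

@[simp] lemma exponent_oplus (x y : Trop m) (i : Fin m) :
    (oplus x y).exponent i = min (x.exponent i) (y.exponent i) := rfl

lemma eq_of_exponent {x y : Trop m} (h : ∀ i, x.exponent i = y.exponent i) : x = y :=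
  Multiplicative.toAdd.injective (funext h)

lemma eq_prod_gen (x : Trop m) : x = ∏ i, gen i ^ x.exponent i := by
  apply Multiplicative.toAdd.injective
  rw [toAdd_prod]
  ext j
  rw [Finset.sum_apply, Finset.sum_eq_single j]
  · simp [gen, exponent]
  · intro i _ hij
    simp [gen, Pi.single_eq_of_ne hij.symm]
  · simp

end Trop

/-- The correction term in matrix mutation, in terms of positive and negative parts. -/
lemma sign_mul_max (a b : ℤ) : a.sign * max (a * b) 0 = a * max b 0 + max (-a) 0 * b := by
  rcases lt_trichotomy a 0 with ha | rfl | ha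
  · rw [Int.sign_eq_neg_one_of_neg ha, max_eq_left (by omega : 0 ≤ -a)]
    rcases le_total b 0 with hb | hb
    · rw [max_eq_left (mul_nonneg_of_nonpos_of_nonpos ha.le hb), max_eq_right hb]; ring
    · rw [max_eq_right (mul_nonpos_of_nonpos_of_nonneg ha.le hb), max_eq_left hb]; ring
  · simp
  · rw [Int.sign_eq_one_of_pos ha, max_eq_right (by omega : -a ≤ 0)]
    rcases le_total b 0 with hb | hb
    · rw [max_eq_right (mul_nonpos_of_nonneg_of_nonpos ha.le hb), max_eq_right hb]; ring
    · rw [max_eq_left (mul_nonneg ha.le hb), max_eq_left hb]; ring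

namespace Seed

/-- The column of the extended exchange matrix with index `k`, the exponent vector of the exchange
relation in direction `k`. -/
def col {n m : ℕ} {F : Type*} (s : Seed n m F) (k : Fin n) : Fin n ⊕ Fin m → ℤ :=
  fun i => s.extendedMatrix i k

@[simp] lemma col_inl {n m : ℕ} {F : Type*} (s : Seed n m F) (k j : Fin n) :
    s.col k (Sum.inl j) = s.B j k := rfl

@[simp] lemma col_inr {n m : ℕ} {F : Type*} (s : Seed n m F) (k : Fin n) (j : Fin m) :
    s.col k (Sum.inr j) = (s.X k).exponent j := rfl

variable {K F : Type*} [CommRing K] [Field F] {n m : ℕ} [Algebra (CoeffRing K m) F]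

variable (K) in
/-- The extended cluster of a seed: the cluster together with the coefficient variables `Z_j`. -/
noncomputable def extCluster (s : Seed n m F) : Fin n ⊕ Fin m → F :=
  Sum.elim s.A fun j => coeff K F (Trop.gen j)

@[simp] lemma extCluster_inl (s : Seed n m F) (j : Fin n) :
    s.extCluster K (Sum.inl j) = s.A j := rfl

@[simp] lemma extCluster_inr (s : Seed n m F) (j : Fin m) :
    s.extCluster K (Sum.inr j) = coeff K F (Trop.gen j) := rfl

variable (K F) in
/-- The inclusion of the tropical semifield, as a multiplicative group, into the ambient field. -/
noncomputable def coeffHom (m : ℕ) [Algebra (CoeffRing K m) F] : Trop m →* F :=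
  ((algebraMap (CoeffRing K m) F : CoeffRing K m →* F)).comp (MonoidAlgebra.of K (Trop m))

lemma coeffHom_apply (p : Trop m) : coeffHom K F m p = coeff K F p := rfl

lemma coeff_inv (p : Trop m) : coeff K F p⁻¹ = (coeff K F p)⁻¹ := by
  refine eq_inv_of_mul_eq_one_left ?_
  rw [← coeffHom_apply, ← coeffHom_apply, ← map_mul, inv_mul_cancel, map_one]

lemma coeff_eq_prod (p : Trop m) : coeff K F p = ∏ j, coeff K F (Trop.gen j) ^ p.exponent j := by
  conv_lhs => rw [Trop.eq_prod_gen p]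
  simp only [← coeffHom_apply]
  rw [map_prod]
  exact Finset.prod_congr rfl fun j _ => map_zpow' _ coeff_inv _ _

lemma mon_extCluster (s : Seed n m F) (e : Fin n ⊕ Fin m → ℤ) :
    mon (s.extCluster K) e = (∏ j, s.A j ^ e (Sum.inl j)) *
      coeff K F (Multiplicative.ofAdd fun j => e (Sum.inr j)) := by
  rw [mon, Fintype.prod_sum_type, coeff_eq_prod]
  rfl

/-- Since `1 ⊕ X_k` has exponents `min 0 c_{jk}`, the coefficients of the exchange relation are the
monomials given by the positive and the negative part of the column of coefficients. -/
lemma exchangeBinomial_eq (s : Seed n m F) (k : Fin n) :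
    s.exchangeBinomial K k = exchangePoly (s.extCluster K) (s.col k) := by
  rw [exchangePoly, mon_extCluster, mon_extCluster, exchangeBinomial]
  congr 1
  · rw [mul_comm]
    congr 1
    · refine Finset.prod_congr rfl fun j _ => ?_
      rw [← zpow_natCast, Int.toNat_eq_max, Pi.posPart_apply]
      rfl
    · congr 1
      refine Trop.eq_of_exponent fun j => ?_
      change (s.X k).exponent j - min 0 ((s.X k).exponent j) = max ((s.X k).exponent j) 0
      omega
  · rw [mul_comm]
    congr 1
    · refine Finset.prod_congr rfl fun j _ => ?_
      rw [← zpow_natCast, Int.toNat_eq_max, Pi.negPart_apply]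
      rfl
    · congr 1
      refine Trop.eq_of_exponent fun j => ?_
      change 0 - min 0 ((s.X k).exponent j) = max (-(s.X k).exponent j) 0
      omega

/-- Mutation exchanges one variable of the extended cluster. -/
lemma extCluster_mutate (s : Seed n m F) (k : Fin n) :
    (s.mutate K k).extCluster K = Function.update (s.extCluster K) (Sum.inl k)
      (exchangePoly (s.extCluster K) (s.col k) / s.extCluster K (Sum.inl k)) := by
  ext i
  rcases i with j | j
  · by_cases hj : j = k
    · subst hj
      rw [Function.update_self, ← exchangeBinomial_eq, extCluster_inl, extCluster_inl,
        div_eq_inv_mul]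
      exact if_pos rfl
    · rw [Function.update_of_ne (by simpa using hj)]
      exact if_neg hj
  · rw [Function.update_of_ne (by simp)]
    rfl

/-- The mutation rules of the exchange matrix and of the coefficient tuple are one rule for the
columns of the extended exchange matrix. -/
lemma col_mutate (s : Seed n m F) (p j : Fin n) (i : Fin n ⊕ Fin m) :
    (s.mutate K p).col j i = if i = Sum.inl p ∨ j = p then -s.col j i
      else s.col j i + (s.col p i).sign * max (s.col p i * s.col j (Sum.inl p)) 0 := by
  rcases i with i | i
  · simp only [col_inl, Sum.inl.injEq]
    rfl
  · simp only [col_inr, col_inl, reduceCtorEq, false_or]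
    change Trop.exponent (if j = p then _ else _) i = _
    split_ifs with hj
    · rw [Trop.exponent_inv, hj]
    · rw [sign_mul_max]
      simp only [Trop.exponent_mul, Trop.exponent_zpow, Trop.exponent_oplus, Trop.exponent_one]
      have : max (-(s.X p).exponent i) 0 = -min 0 ((s.X p).exponent i) := by omega
      rw [this]
      ring

lemma A_mem_laurentRing (s : Seed n m F) (i : Fin n) : s.A i ∈ s.laurentRing K :=
  Algebra.subset_adjoin (Or.inl ⟨i, rfl⟩)

lemma inv_A_mem_laurentRing (s : Seed n m F) (i : Fin n) : (s.A i)⁻¹ ∈ s.laurentRing K :=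
  Algebra.subset_adjoin (Or.inr ⟨i, rfl⟩)

lemma coeff_mem_laurentRing (s : Seed n m F) (p : Trop m) : coeff K F p ∈ s.laurentRing K :=
  Subalgebra.algebraMap_mem (s.laurentRing K) _

/-- A seed with the properties on which the argument rests, all of which are stable under mutation:
the extended cluster is algebraically independent over `K`, and the columns of the extended exchange
matrix are primitive and linearly independent. -/
structure IsPrimitiveSeed (K : Type*) [CommRing K] [Algebra (CoeffRing K m) F] [Algebra K F]
    (s : Seed n m F) : Prop where
  skew : IsSkewSymmetrizable s.B
  indep : AlgebraicIndependent K (s.extCluster K)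
  primitive : ∀ k, IsPrimitiveVector (s.col k)
  linearIndep : ∀ c : Fin n → ℤ, (∀ i, ∑ k, c k * s.col k i = 0) → c = 0

end Seed

lemma IsSkewSymmetrizable.exists_mul_eq {n : ℕ} {B : Matrix (Fin n) (Fin n) ℤ}
    (h : IsSkewSymmetrizable B) :
    ∃ S : Fin n → ℤ, (∀ i, 0 < S i) ∧ ∀ i j, S i * B i j = -(S j * B j i) := by
  obtain ⟨S, hS, h⟩ := h
  refine ⟨S, hS, fun i j => ?_⟩
  have h1 := congrFun (congrFun h j) i
  simpa [Matrix.transpose_apply, Matrix.diagonal_mul] using h1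

lemma IsSkewSymmetrizable.of_mul_eq {n : ℕ} {B : Matrix (Fin n) (Fin n) ℤ} {S : Fin n → ℤ}
    (hS : ∀ i, 0 < S i) (h : ∀ i j, S i * B i j = -(S j * B j i)) : IsSkewSymmetrizable B := by
  refine ⟨S, hS, ?_⟩
  ext j i
  simpa [Matrix.transpose_apply, Matrix.diagonal_mul] using h i j

lemma IsSkewSymmetrizable.diag_eq_zero {n : ℕ} {B : Matrix (Fin n) (Fin n) ℤ}
    (h : IsSkewSymmetrizable B) (i : Fin n) : B i i = 0 := by
  obtain ⟨S, hS, h⟩ := h.exists_mul_eq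
  have h1 := h i i
  have h2 := hS i
  have h3 : S i * B i i = 0 := by omega
  exact (mul_eq_zero.mp h3).resolve_left h2.ne'

lemma IsSkewSymmetrizable.sign_eq {n : ℕ} {B : Matrix (Fin n) (Fin n) ℤ}
    (h : IsSkewSymmetrizable B) (i j : Fin n) : (B i j).sign = -(B j i).sign := by
  obtain ⟨S, hS, h⟩ := h.exists_mul_eq
  have h1 := congrArg Int.sign (h i j)
  rwa [Int.sign_neg, Int.sign_mul, Int.sign_mul, Int.sign_eq_one_of_pos (hS i),
    Int.sign_eq_one_of_pos (hS j), one_mul, one_mul] at h1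

lemma IsSkewSymmetrizable.mutate {n : ℕ} {B : Matrix (Fin n) (Fin n) ℤ}
    (h : IsSkewSymmetrizable B) (k : Fin n) : IsSkewSymmetrizable (mutateMatrix k B) := by
  obtain ⟨S, hS, h⟩ := h.exists_mul_eq
  refine .of_mul_eq hS fun i j => ?_
  rw [mutateMatrix, mutateMatrix]
  have hmax : ∀ a b, S a * max (B a b) 0 = S b * max (-B b a) 0 := fun a b => by
    rw [mul_max_of_nonneg _ _ (hS a).le, mul_max_of_nonneg _ _ (hS b).le, h a b]
    simp
  have hmax' : ∀ a b, S a * max (-B a b) 0 = S b * max (B b a) 0 := fun a b => (hmax b a).symm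
  by_cases hc : i = k ∨ j = k
  · rw [if_pos hc, if_pos hc.symm]
    linear_combination -h i j
  · rw [if_neg hc, if_neg fun h => hc h.symm, sign_mul_max, sign_mul_max]
    change S i * (B i j + (B i k * max (B k j) 0 + max (-B i k) 0 * B k j)) =
      -(S j * (B j i + (B j k * max (B k i) 0 + max (-B j k) 0 * B k i)))
    have h0 := h i j
    have e : ∀ b : ℤ, b = max b 0 - max (-b) 0 := fun b => by omega
    have h1 := hmax i k
    have h2 := hmax' i k
    have h3 := hmax k j
    have h4 := hmax' k j
    have e1 := e (B i k)
    have e2 := e (B k j)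
    have e3 := e (B j k)
    have e4 := e (B k i)
    generalize max (B i k) 0 = a1 at *
    generalize max (-B i k) 0 = a2 at *
    generalize max (B k j) 0 = b1 at *
    generalize max (-B k j) 0 = b2 at *
    generalize max (B j k) 0 = c1 at *
    generalize max (-B j k) 0 = c2 at *
    generalize max (B k i) 0 = d1 at *
    generalize max (-B k i) 0 = d2 at *
    rw [e1, e2, e3, e4]
    linear_combination h0 + b1 * h1 - b2 * h2 + d2 * h3 - d1 * h4

namespace Seed

variable {K F : Type*} [CommRing K] [Field F] {n m : ℕ} [Algebra (CoeffRing K m) F] [Algebra K F]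
  {s : Seed n m F}

namespace IsPrimitiveSeed

variable (hs : s.IsPrimitiveSeed K)
include hs

lemma col_self (k : Fin n) : s.col k (Sum.inl k) = 0 := hs.skew.diag_eq_zero k

lemma not_proportional {p k : Fin n} (hpk : p ≠ k) (c : ℤ) : s.col p ≠ c • s.col k := fun h => by
  have h1 := hs.linearIndep (Pi.single p 1 - Pi.single k c) fun i => by
    have h2 := congrFun h i
    simp only [Pi.sub_apply, sub_mul, Finset.sum_sub_distrib, Pi.single_apply, ite_mul, one_mul,
      zero_mul, Finset.sum_ite_eq', Finset.mem_univ, if_true]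
    rw [h2, Pi.smul_apply, smul_eq_mul, sub_self]
  have h2 := congrFun h1 p
  simp [hpk] at h2

/-- The gcd of the entries of column `k` divides its entry at `p`, and mutation in direction `p`
adds multiples of that entry to the other entries and negates it. -/
lemma primitive_mutate (p k : Fin n) : IsPrimitiveVector ((s.mutate K p).col k) := by
  intro d hd
  refine hs.primitive k d fun i => ?_
  have hdp : d ∣ s.col k (Sum.inl p) := by
    have := hd (Sum.inl p)
    rwa [col_mutate, if_pos (Or.inl rfl), dvd_neg] at this
  have h1 := hd i
  rw [col_mutate] at h1
  split_ifs at h1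
  · rwa [dvd_neg] at h1
  · refine (dvd_add_left (Dvd.dvd.mul_left ?_ _)).mp h1
    rcases max_choice (s.col p i * s.col k (Sum.inl p)) 0 with h | h <;> rw [h]
    · exact hdp.mul_left _
    · exact dvd_zero _

lemma linearIndep_mutate (p : Fin n) (c : Fin n → ℤ)
    (hc : ∀ i, ∑ k, c k * (s.mutate K p).col k i = 0) : c = 0 := by
  have hpp := hs.col_self p
  have hrow : ∑ k, c k * s.col k (Sum.inl p) = 0 := by
    have := hc (Sum.inl p)
    simp only [col_mutate, true_or, if_true, mul_neg, Finset.sum_neg_distrib] at this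
    exact neg_eq_zero.mp this
  -- Mutation adds multiples of column `p` and of row `p` to the matrix and changes the sign of
  -- both, so a relation between the new columns is one between the old ones with changed
  -- coefficient at `p`.
  set τ := ∑ k, c k * max (s.col k (Sum.inl p)) 0 with hτ
  have hd := hs.linearIndep (fun k => c k + if k = p then -2 * c p + τ else 0) fun i => by
    simp only [add_mul, Finset.sum_add_distrib, ite_mul, zero_mul, Finset.sum_ite_eq',
      Finset.mem_univ, if_true]
    by_cases hi : i = Sum.inl p
    · rw [hi, hrow, hpp]; simp
    · have h1 := hc i
      have h2 : ∀ k, c k * (s.mutate K p).col k i = c k * s.col k i +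
          s.col p i * (c k * max (s.col k (Sum.inl p)) 0) +
          max (-s.col p i) 0 * (c k * s.col k (Sum.inl p)) +
          (if k = p then -2 * c p * s.col p i else 0) := fun k => by
        rw [col_mutate]
        by_cases hk : k = p
        · subst hk
          rw [if_pos (Or.inr rfl), if_pos rfl, hpp]; simp; ring
        · rw [if_neg (not_or.mpr ⟨hi, hk⟩), if_neg hk, sign_mul_max]; ring
      rw [Finset.sum_congr rfl fun k _ => h2 k, Finset.sum_add_distrib, Finset.sum_add_distrib,
        Finset.sum_add_distrib, ← Finset.mul_sum, ← Finset.mul_sum, ← hτ, hrow,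
        Finset.sum_ite_eq', if_pos (Finset.mem_univ p)] at h1
      linear_combination h1
  have hne : ∀ k ≠ p, c k = 0 := fun k hk => by
    have := congrFun hd k
    simpa [hk] using this
  have hτ0 : τ = 0 := Finset.sum_eq_zero fun k _ => by
    by_cases hk : k = p
    · rw [hk, hpp, max_self, mul_zero]
    · rw [hne k hk, zero_mul]
  ext k
  by_cases hk : k = p
  · have := congrFun hd p
    rw [hτ0] at this
    simp only [if_true, Pi.zero_apply] at this
    rw [hk, Pi.zero_apply]
    omega
  · exact hne k hk

variable [IsDomain K]

lemma exchangePoly_ne_zero (k : Fin n) : exchangePoly (s.extCluster K) (s.col k) ≠ 0 :=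
  ClusterAlgebra.exchangePoly_ne_zero hs.indep.ne_zero hs.indep (hs.primitive k)

lemma mutate (p : Fin n) : (s.mutate K p).IsPrimitiveSeed K where
  skew := hs.skew.mutate p
  indep := by
    rw [extCluster_mutate]
    refine algebraicIndependent_update hs.indep _ (exchangePoly_mem ?_) (hs.exchangePoly_ne_zero p)
    simpa using hs.col_self p
  primitive := hs.primitive_mutate p
  linearIndep := hs.linearIndep_mutate p

lemma mutate_mutate (p : Fin n) : (s.mutate K p).mutate K p = s := by
  have hcol : ∀ k i, ((s.mutate K p).mutate K p).col k i = s.col k i := fun k i => by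
    rw [col_mutate]
    split_ifs with h
    · rw [col_mutate, if_pos h, neg_neg]
    · rw [col_mutate, if_neg h, col_mutate s p p i, if_pos (Or.inr rfl),
        col_mutate s p k (Sum.inl p), if_pos (Or.inl rfl), Int.sign_neg, neg_mul_neg]
      ring
  have hA : ((s.mutate K p).mutate K p).extCluster K = s.extCluster K := by
    have hcp : (s.mutate K p).col p = -s.col p := by
      ext i
      rw [col_mutate, if_pos (Or.inr rfl), Pi.neg_apply]
    rw [extCluster_mutate, extCluster_mutate, hcp, exchangePoly_neg, Function.update_self,
      Function.update_idem]
    have h1 : exchangePoly (Function.update (s.extCluster K) (Sum.inl p)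
        (exchangePoly (s.extCluster K) (s.col p) / s.extCluster K (Sum.inl p))) (s.col p) =
        exchangePoly (s.extCluster K) (s.col p) :=
      exchangePoly_congr fun i hi => Function.update_of_ne
        (by rintro rfl; exact hi (hs.col_self p)) _ _
    rw [h1, div_div_cancel₀ (hs.exchangePoly_ne_zero p), Function.update_eq_self]
  rcases hs' : (s.mutate K p).mutate K p with ⟨B, X, A⟩
  rcases s with ⟨B', X', A'⟩
  rw [hs'] at hcol hA
  congr 1
  · ext i j
    exact hcol j (Sum.inl i)
  · ext1 k
    exact Trop.eq_of_exponent fun i => hcol k (Sum.inr i)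
  · ext1 i
    exact congrFun hA (Sum.inl i)

end IsPrimitiveSeed

section LaurentRing

variable [IsScalarTower K (CoeffRing K m) F]

lemma mem_laurentRing_iff (s : Seed n m F) {f : F} :
    f ∈ s.laurentRing K ↔ f ∈ laurent K (s.extCluster K) Set.univ := by
  constructor
  · intro hf
    induction hf using Algebra.adjoin_induction with
    | mem y hy =>
      rcases hy with ⟨i, rfl⟩ | ⟨i, rfl⟩
      · exact mem_laurent (x := s.extCluster K) (Set.mem_univ (Sum.inl i))
      · exact inv_mem_laurent (x := s.extCluster K) (Set.mem_univ (Sum.inl i))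
    | algebraMap r =>
      induction r using MonoidAlgebra.induction_linear with
      | zero => rw [map_zero]; exact zero_mem _
      | add f g hf hg => rw [map_add]; exact add_mem hf hg
      | single a r =>
        have h1 : (MonoidAlgebra.single a r : CoeffRing K m) =
            r • MonoidAlgebra.of K (Trop m) a := by
          rw [MonoidAlgebra.of_apply, MonoidAlgebra.smul_single, smul_eq_mul, mul_one]
        rw [h1, Algebra.algebraMap_eq_smul_one, smul_assoc, ← Algebra.algebraMap_eq_smul_one]
        refine Subalgebra.smul_mem _ ?_ r
        change coeff K F a ∈ _
        rw [coeff_eq_prod]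
        exact prod_mem fun j _ =>
          zpow_mem_laurent (x := s.extCluster K) (Set.mem_univ (Sum.inr j)) _
    | add a b _ _ ha hb => exact add_mem ha hb
    | mul a b _ _ ha hb => exact mul_mem ha hb
  · intro hf
    have h : laurent K (s.extCluster K) Set.univ ≤ (s.laurentRing K).restrictScalars K := by
      refine laurent_le ?_
      rintro (i | i) -
      · exact ⟨A_mem_laurentRing s i, inv_A_mem_laurentRing s i⟩
      · refine ⟨coeff_mem_laurentRing s _, ?_⟩
        rw [extCluster_inr, ← coeff_inv]
        exact coeff_mem_laurentRing s _
    exact h hf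

end LaurentRing

end Seed

/-! ### The upper cluster algebra as an intersection at one seed -/

lemma polyToCoeffRing_injective (K : Type*) [CommRing K] (m : ℕ) :
    Function.Injective (polyToCoeffRing K m) := by
  have h : polyToCoeffRing K m =
      ((AddMonoidAlgebra.toMultiplicativeAlgEquiv K K (Fin m → ℤ)).toAlgHom.comp
        (LaurentRing.ofMvPolynomial K (Fin m))).toRingHom := by
    rw [polyToCoeffRing]
    congr 1
    refine MvPolynomial.algHom_ext fun i => ?_
    rw [MvPolynomial.aeval_X, AlgHom.comp_apply, MvPolynomial.X,
      LaurentRing.ofMvPolynomial_monomial]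
    change _ = AddMonoidAlgebra.toMultiplicativeAlgEquiv K K (Fin m → ℤ) _
    rw [AddMonoidAlgebra.toMultiplicativeAlgEquiv_single, MonoidAlgebra.of_apply, Trop.gen]
    congr 2
    ext j
    simp [Finsupp.single_apply, Pi.single_apply, eq_comm]
  rw [h]
  exact (AddMonoidAlgebra.toMultiplicativeAlgEquiv K K (Fin m → ℤ)).injective.comp
    LaurentRing.ofMvPolynomial_injective

lemma algebraicIndependent_gen (K : Type*) [CommRing K] (m : ℕ) :
    AlgebraicIndependent K fun i => MonoidAlgebra.of K (Trop m) (Trop.gen i) :=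
  polyToCoeffRing_injective K m

/-- The columns of an integer matrix with `n` columns and rank `n` are linearly independent. -/
lemma eq_zero_of_rank_eq {ι : Type*} [Fintype ι] {n : ℕ} {M : Matrix ι (Fin n) ℤ}
    (hM : (M.map (Int.cast : ℤ → ℚ)).rank = n) {c : Fin n → ℤ}
    (hc : ∀ i, ∑ k, c k * M i k = 0) : c = 0 := by
  have h1 : LinearIndependent ℚ (M.map (Int.cast : ℤ → ℚ)).col := by
    rw [linearIndependent_iff_card_eq_finrank_span, Fintype.card_fin, Set.finrank,
      ← Matrix.rank_eq_finrank_span_cols, hM]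
  rw [Fintype.linearIndependent_iff] at h1
  ext k
  have := h1 (fun k => (c k : ℚ)) (by
    ext i
    rw [Finset.sum_apply]
    simp only [Pi.smul_apply, Matrix.col_apply, Matrix.map_apply, smul_eq_mul, Pi.zero_apply]
    exact_mod_cast hc i) k
  exact_mod_cast this

section Neighbour

variable {K F ι : Type*} [CommRing K] [IsDomain K] [Field F] [Algebra K F] [Fintype ι]
  [DecidableEq ι] {x : ι → F} {β : ι → ℤ} {k : ι} {f g : F}

/-- Up to a unit, the variable `x k` of a seed is the exchange polynomial when it is viewed in the
Laurent polynomial ring of the neighbouring seed in direction `k`. -/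
lemma mem_div_iff_exchangePoly_dvd (hind : AlgebraicIndependent K x) (hβ : IsPrimitiveVector β)
    (hβk : β k = 0) (f : laurent K (Function.update x k (exchangePoly x β / x k)) Set.univ) :
    (f : F) / x k ∈ laurent K (Function.update x k (exchangePoly x β / x k)) Set.univ ↔
      (⟨exchangePoly (Function.update x k (exchangePoly x β / x k)) β, exchangePoly_mem_univ⟩ :
        laurent K (Function.update x k (exchangePoly x β / x k)) Set.univ) ∣ f := by
  have hx := hind.ne_zero
  have hP := exchangePoly_ne_zero hx hind hβ
  have hP' : exchangePoly (Function.update x k (exchangePoly x β / x k)) β = exchangePoly x β :=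
    exchangePoly_congr fun i hi => Function.update_of_ne (by rintro rfl; exact hi hβk) _ _
  have hmem : exchangePoly x β / x k ∈
      laurent K (Function.update x k (exchangePoly x β / x k)) Set.univ := by
    have := mem_laurent (K := K) (x := Function.update x k (exchangePoly x β / x k))
      (Set.mem_univ k)
    rwa [Function.update_self] at this
  have hmem' : (exchangePoly x β / x k)⁻¹ ∈
      laurent K (Function.update x k (exchangePoly x β / x k)) Set.univ := by
    have := inv_mem_laurent (K := K) (x := Function.update x k (exchangePoly x β / x k))
      (Set.mem_univ k)
    rwa [Function.update_self] at this
  have hxk := hx k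
  constructor
  · intro h
    refine ⟨⟨_, mul_mem h hmem'⟩, Subtype.ext ?_⟩
    change (f : F) = exchangePoly _ β * ((f : F) / x k * (exchangePoly x β / x k)⁻¹)
    rw [hP']
    field_simp
  · rintro ⟨g, rfl⟩
    have : ((⟨exchangePoly (Function.update x k (exchangePoly x β / x k)) β,
        exchangePoly_mem_univ⟩ * g :
        laurent K (Function.update x k (exchangePoly x β / x k)) Set.univ) : F) / x k =
        g * (exchangePoly x β / x k) := by
      change exchangePoly _ β * (g : F) / x k = _
      rw [hP']
      ring
    rw [this]
    exact mul_mem g.2 hmem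

end Neighbour

namespace Seed

variable {K F : Type*} [CommRing K] [Field F] {n m : ℕ} [Algebra (CoeffRing K m) F] [Algebra K F]
  {s : Seed n m F} {f : F}

lemma IsPrimitiveSeed.seedAt [IsDomain K] (hs : s.IsPrimitiveSeed K) (t : List (Fin n)) :
    (s.seedAt K t).IsPrimitiveSeed K := by
  induction t with
  | nil => exact hs
  | cons k t ih => exact ih.mutate k

lemma IsPrimitiveSeed.uniqueFactorizationMonoid_laurent [IsDomain K] [UniqueFactorizationMonoid K]
    (hs : s.IsPrimitiveSeed K) :
    UniqueFactorizationMonoid (laurent K (s.extCluster K) Set.univ) :=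
  (laurentEquiv hs.indep.ne_zero hs.indep).toMulEquiv.uniqueFactorizationMonoid
    LaurentRing.uniqueFactorizationMonoid

variable [IsScalarTower K (CoeffRing K m) F]

lemma IsASeed.isPrimitiveSeed (hs : s.IsASeed K) (hfull : s.FullRank) (hprim : s.Primitive) :
    s.IsPrimitiveSeed K where
  skew := hs.skewSymmetrizable
  indep := (algebraicIndependent_gen K m).sumElim_comp hs.algebraicIndependent
  primitive k d hd := by
    have h : d.natAbs ∣ Finset.univ.gcd (fun i => (s.extendedMatrix i k).natAbs) :=
      Finset.dvd_gcd fun i _ => Int.natAbs_dvd_natAbs.mpr (hd i)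
    rw [hprim k, Nat.dvd_one] at h
    exact Int.isUnit_iff_natAbs_eq.mpr h
  linearIndep _ hc := eq_zero_of_rank_eq hfull hc

variable (K) in
/-- Membership in the Laurent polynomial rings of a seed and of all its neighbours. -/
def MemStar (s : Seed n m F) (f : F) : Prop :=
  f ∈ s.laurentRing K ∧ ∀ k, f ∈ (s.mutate K k).laurentRing K

namespace IsPrimitiveSeed

variable [IsDomain K]

/-- The intersection of the Laurent polynomial rings of a seed and of its neighbours is contained in
the one for a neighbouring seed. -/
lemma memStar_mutate (hs : s.IsPrimitiveSeed K) (p : Fin n) (h : s.MemStar K f) :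
    (s.mutate K p).MemStar K f := by
  refine ⟨h.2 p, fun k => ?_⟩
  by_cases hpk : p = k
  · rw [← hpk, hs.mutate_mutate]
    exact h.1
  have h2 := h.2 k
  have h3 := h.2 p
  have hA : s.extCluster K (Sum.inl k) = (s.mutate K p).extCluster K (Sum.inl k) := by
    rw [extCluster_mutate, Function.update_of_ne (by simpa using Ne.symm hpk)]
  rw [mem_laurentRing_iff, extCluster_mutate] at h2 h3 ⊢
  rw [← hA, extCluster_mutate]
  refine mem_laurent_update_update hs.indep (by simpa using hpk) (hs.primitive p)
    (hs.primitive k) (hs.primitive_mutate p k) (hs.col_self p) (hs.col_self k)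
    (hs.skew.sign_eq k p) (hs.not_proportional hpk) (fun i => ?_)
    ((mem_laurentRing_iff s).mp h.1) h2 h3
  rw [col_mutate]
  by_cases hi : i = Sum.inl p
  · rw [if_pos (Or.inl hi), if_pos hi, hi]
  · rw [if_neg hi, if_neg (by simp [hi, Ne.symm hpk])]

lemma memStar_mutate_iff (hs : s.IsPrimitiveSeed K) (p : Fin n) :
    (s.mutate K p).MemStar K f ↔ s.MemStar K f := by
  refine ⟨fun h => ?_, hs.memStar_mutate p⟩
  have := (hs.mutate p).memStar_mutate p h
  rwa [hs.mutate_mutate] at this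

lemma memStar_seedAt_iff (hs : s.IsPrimitiveSeed K) (t : List (Fin n)) :
    (s.seedAt K t).MemStar K f ↔ s.MemStar K f := by
  induction t with
  | nil => rfl
  | cons k t ih => exact ((hs.seedAt t).memStar_mutate_iff k).trans ih

/-- The upper cluster algebra is the intersection of the Laurent polynomial rings of any one seed
and of its neighbours. -/
lemma mem_upperClusterAlgebra_iff (hs : s.IsPrimitiveSeed K) (t : List (Fin n)) :
    f ∈ s.upperClusterAlgebra K ↔ (s.seedAt K t).MemStar K f := by
  rw [upperClusterAlgebra, Algebra.mem_iInf]
  exact ⟨fun h => ⟨h t, fun k => h (k :: t)⟩, fun h t' =>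
    ((hs.memStar_seedAt_iff t').mpr ((hs.memStar_seedAt_iff t).mp h)).1⟩

/-- The upper cluster algebra is glued from the Laurent polynomial rings of any one seed and of its
neighbours. -/
lemma isPrimeGluing [UniqueFactorizationMonoid K] (hs : s.IsPrimitiveSeed K) (t : List (Fin n)) :
    IsPrimeGluing ((s.upperClusterAlgebra K).restrictScalars K)
      (laurent K ((s.seedAt K t).extCluster K) Set.univ)
      (fun k => laurent K ((s.seedAt K (k :: t)).extCluster K) Set.univ) (s.seedAt K t).A := by
  have hr := hs.seedAt t
  have hx := hr.indep.ne_zero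
  have hmut : ∀ k, (s.seedAt K (k :: t)).extCluster K = _ := fun k =>
    extCluster_mutate (s.seedAt K t) k
  have hmut_ne : ∀ j k, j ≠ k →
      (s.seedAt K (j :: t)).extCluster K (Sum.inl k) = (s.seedAt K t).A k := fun j k hjk => by
    rw [hmut, Function.update_of_ne (by simpa using hjk.symm)]; rfl
  have hA : ∀ k, (s.seedAt K t).extCluster K (Sum.inl k) = (s.seedAt K t).A k := fun k => rfl
  have hU : ∀ f, f ∈ s.upperClusterAlgebra K ↔ (s.seedAt K t).MemStar K f := fun f =>
    hs.mem_upperClusterAlgebra_iff t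
  have hP := fun k => prime_exchangePoly (hs.seedAt (k :: t)).indep.ne_zero
    (hs.seedAt (k :: t)).indep (hr.primitive k)
  have hdvd : ∀ k (f : laurent K ((s.seedAt K (k :: t)).extCluster K) Set.univ),
      (f : F) / (s.seedAt K t).A k ∈ laurent K ((s.seedAt K (k :: t)).extCluster K) Set.univ ↔
      (⟨exchangePoly ((s.seedAt K (k :: t)).extCluster K) ((s.seedAt K t).col k),
        exchangePoly_mem_univ⟩ : laurent K ((s.seedAt K (k :: t)).extCluster K) Set.univ) ∣ f :=
    fun k => by
      rw [hmut]
      exact mem_div_iff_exchangePoly_dvd hr.indep (hr.primitive k) (hr.col_self k)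
  have hAeq : ∀ j, (s.seedAt K t).A j = exchangePoly ((s.seedAt K (j :: t)).extCluster K)
      ((s.seedAt K t).col j) * ((s.seedAt K (j :: t)).extCluster K (Sum.inl j))⁻¹ := fun j => by
    have h2 : exchangePoly ((s.seedAt K (j :: t)).extCluster K) ((s.seedAt K t).col j) =
        exchangePoly ((s.seedAt K t).extCluster K) ((s.seedAt K t).col j) :=
      exchangePoly_congr fun i hi => by
        rw [hmut, Function.update_of_ne (by rintro rfl; exact hi (hr.col_self j))]
    rw [h2, hmut, Function.update_self, ← div_eq_mul_inv,
      div_div_cancel₀ (hr.exchangePoly_ne_zero j), hA]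
  have hmem : ∀ j k, (s.seedAt K t).A k ∈
      laurent K ((s.seedAt K (j :: t)).extCluster K) Set.univ := fun j k => by
    by_cases hjk : j = k
    · rw [← hjk, hAeq j]
      exact mul_mem exchangePoly_mem_univ (inv_mem_laurent (Set.mem_univ _))
    · rw [← hmut_ne j k hjk]
      exact mem_laurent (Set.mem_univ _)
  refine ⟨fun f => ?_, fun k => hx (Sum.inl k), fun k => ?_, fun k => ?_, hmem, fun j k hjk => ?_,
    fun k hk => ?_, fun k f hf g hg h => ?_, fun k f hf => ?_, fun k f hf hf0 => ?_⟩
  · change f ∈ s.upperClusterAlgebra K ↔ _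
    rw [hU, MemStar, mem_laurentRing_iff]
    exact and_congr_right' (forall_congr' fun k => mem_laurentRing_iff _)
  · exact mem_laurent (x := (s.seedAt K t).extCluster K) (Set.mem_univ (Sum.inl k))
  · exact inv_mem_laurent (x := (s.seedAt K t).extCluster K) (Set.mem_univ (Sum.inl k))
  · rw [← hmut_ne j k hjk]
    exact inv_mem_laurent (Set.mem_univ _)
  · rw [← one_div] at hk
    exact (hP k).not_isUnit (isUnit_of_dvd_one ((hdvd k 1).mp hk))
  · exact ((hP k).dvd_or_dvd ((hdvd k (⟨f, hf⟩ * ⟨g, hg⟩)).mp h)).imp (hdvd k ⟨f, hf⟩).mpr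
      (hdvd k ⟨g, hg⟩).mpr
  · obtain ⟨N, p, hp⟩ := (laurentOver_iff (hx (Sum.inl k))).mpr hf
    refine ⟨N, ?_⟩
    rw [hA] at hp
    rw [hp, aeval_eq_sum_range]
    refine sum_mem fun i _ => ?_
    rw [Algebra.smul_def]
    refine mul_mem ?_ (pow_mem (hmem k k) i)
    have h1 : laurent K ((s.seedAt K t).extCluster K) {Sum.inl k}ᶜ ≤
        laurent K ((s.seedAt K (k :: t)).extCluster K) Set.univ := by
      rw [laurent_congr (x' := (s.seedAt K (k :: t)).extCluster K) fun i hi => by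
        rw [hmut, Function.update_of_ne hi]]
      exact laurent_mono (Set.subset_univ _)
    exact h1 (p.coeff i).2
  -- In a unique factorization domain a nonzero element is not divisible by all powers of a nonunit.
  · have : UniqueFactorizationMonoid (laurent K ((s.seedAt K (k :: t)).extCluster K) Set.univ) :=
      (hs.seedAt (k :: t)).uniqueFactorizationMonoid_laurent
    by_contra! h
    obtain ⟨N, hN⟩ := FiniteMultiplicity.of_not_isUnit (hP k).not_isUnit
      (show (⟨f, hf⟩ : laurent K ((s.seedAt K (k :: t)).extCluster K) Set.univ) ≠ 0 from
        fun h0 => hf0 (congrArg Subtype.val h0))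
    refine hN ⟨⟨_, mul_mem (h (N + 1)) (pow_mem (inv_mem_laurent (Set.mem_univ (Sum.inl k)))
      (N + 1))⟩, Subtype.ext ?_⟩
    change f = exchangePoly _ _ ^ (N + 1) * (f / _ ^ (N + 1) * (_)⁻¹ ^ (N + 1))
    rw [mul_left_comm, ← mul_pow, ← hAeq k]
    exact (div_mul_cancel₀ _ (pow_ne_zero _ (hx (Sum.inl k)))).symm

end IsPrimitiveSeed

end Seed

/-! ### Leading terms of cluster variables -/

section LeadingTerm

variable {K ι Γ : Type*} [CommRing K] [AddCommGroup Γ] [LinearOrder Γ]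
  {D : (ι → ℤ) →+ Γ} {f g : LaurentRing K ι} {γ δ : ι → ℤ} {r r' : K}

/-- The Laurent polynomial `f` has coefficient `r` at the exponent `γ`, and no exponent of `f` is
smaller than `γ` for the order on exponents given by `D`. -/
structure IsLeadingTerm (D : (ι → ℤ) →+ Γ) (f : LaurentRing K ι) (γ : ι → ℤ) (r : K) : Prop where
  coeff_eq : f.coeff γ = r
  le : ∀ δ, f.coeff δ ≠ 0 → D γ ≤ D δ

lemma isLeadingTerm_single (γ : ι → ℤ) (r : K) :
    IsLeadingTerm D (AddMonoidAlgebra.single γ r) γ r := by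
  classical
  refine ⟨by simp, fun δ hδ => ?_⟩
  rw [AddMonoidAlgebra.coeff_single, Finsupp.single_apply] at hδ
  split_ifs at hδ with h
  · rw [h]
  · exact absurd rfl hδ

lemma isLeadingTerm_one : IsLeadingTerm D (1 : LaurentRing K ι) 0 1 := isLeadingTerm_single 0 1

lemma exists_isLeadingTerm (D : (ι → ℤ) →+ Γ) (hf : f ≠ 0) :
    ∃ γ r, r ≠ 0 ∧ IsLeadingTerm D f γ r := by
  have h : f.coeff.support.Nonempty := by
    rw [Finsupp.support_nonempty_iff]
    exact fun h => hf (AddMonoidAlgebra.coeff_eq_zero.mp h)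
  obtain ⟨γ, hγ, hmin⟩ := f.coeff.support.exists_min_image D h
  exact ⟨γ, _, Finsupp.mem_support_iff.mp hγ, rfl, fun δ hδ =>
    hmin δ (Finsupp.mem_support_iff.mpr hδ)⟩

namespace IsLeadingTerm

lemma unique (hD : Function.Injective D) (hf : IsLeadingTerm D f γ r) (hf' : IsLeadingTerm D f δ r')
    (hr : r ≠ 0) (hr' : r' ≠ 0) : γ = δ ∧ r = r' := by
  have h : γ = δ := hD (le_antisymm (hf.le δ (hf'.coeff_eq ▸ hr')) (hf'.le γ (hf.coeff_eq ▸ hr)))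
  exact ⟨h, by rw [← hf.coeff_eq, ← hf'.coeff_eq, h]⟩

lemma add_of_lt (hf : IsLeadingTerm D f γ r) (hg : IsLeadingTerm D g δ r') (h : D γ < D δ) :
    IsLeadingTerm D (f + g) γ r := by
  have hg0 : g.coeff γ = 0 := by_contra fun h0 => (hg.le γ h0).not_gt h
  refine ⟨by rw [AddMonoidAlgebra.coeff_add, Finsupp.add_apply, hf.coeff_eq, hg0, add_zero],
    fun ε hε => ?_⟩
  rw [AddMonoidAlgebra.coeff_add, Finsupp.add_apply] at hε
  by_cases h0 : f.coeff ε = 0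
  · rw [h0, zero_add] at hε
    exact h.le.trans (hg.le ε hε)
  · exact hf.le ε h0

/-- The two leading terms of a sum cannot cancel if their exponents are distinct. -/
lemma exists_add (hD : Function.Injective D) (hf : IsLeadingTerm D f γ r)
    (hg : IsLeadingTerm D g δ r) (h : γ ≠ δ) :
    ∃ ε, (ε = γ ∨ ε = δ) ∧ D ε ≤ D γ ∧ D ε ≤ D δ ∧ IsLeadingTerm D (f + g) ε r := by
  rcases lt_or_gt_of_ne (hD.ne h) with h | h
  · exact ⟨γ, Or.inl rfl, le_rfl, h.le, hf.add_of_lt hg h⟩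
  · exact ⟨δ, Or.inr rfl, h.le, le_rfl, add_comm f g ▸ hg.add_of_lt hf h⟩

variable [IsOrderedAddMonoid Γ]

lemma mul (hD : Function.Injective D) (hf : IsLeadingTerm D f γ r) (hg : IsLeadingTerm D g δ r') :
    IsLeadingTerm D (f * g) (γ + δ) (r * r') := by
  classical
  refine ⟨?_, fun ε hε => ?_⟩
  · rw [AddMonoidAlgebra.coeff_mul_add_of_uniqueAdd, hf.coeff_eq, hg.coeff_eq]
    intro a b ha hb hab
    have h1 := hf.le a (Finsupp.mem_support_iff.mp ha)
    have h2 := hg.le b (Finsupp.mem_support_iff.mp hb)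
    have h3 : D a + D b = D γ + D δ := by rw [← map_add, ← map_add, hab]
    have h4 : D a = D γ := le_antisymm
      (le_of_add_le_add_right (h3.le.trans (add_le_add_right h2 _))) h1
    have h5 := hD h4
    exact ⟨h5, by rwa [h5, add_right_inj] at hab⟩
  · have h := AddMonoidAlgebra.support_coeff_mul_subset f g (Finsupp.mem_support_iff.mpr hε)
    obtain ⟨a, ha, b, hb, rfl⟩ := Finset.mem_add.mp h
    rw [map_add, map_add]
    exact add_le_add (hf.le a (Finsupp.mem_support_iff.mp ha))
      (hg.le b (Finsupp.mem_support_iff.mp hb))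

lemma pow (hD : Function.Injective D) (hf : IsLeadingTerm D f γ 1) (N : ℕ) :
    IsLeadingTerm D (f ^ N) (N • γ) 1 := by
  induction N with
  | zero => simpa using isLeadingTerm_one
  | succ N ih => simpa [pow_succ, add_smul] using ih.mul hD hf

lemma prod {κ : Type*} (hD : Function.Injective D) {a : κ → LaurentRing K ι} {e : κ → ι → ℤ}
    (h : ∀ i, IsLeadingTerm D (a i) (e i) 1) (s : Finset κ) :
    IsLeadingTerm D (∏ i ∈ s, a i) (∑ i ∈ s, e i) 1 := by
  classical
  induction s using Finset.induction_on with
  | empty => simpa using isLeadingTerm_one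
  | insert i s hi ih =>
    rw [Finset.prod_insert hi, Finset.sum_insert hi]
    simpa using (h i).mul hD ih

lemma of_mul [IsDomain K] (hD : Function.Injective D) (hf : IsLeadingTerm D f γ 1)
    (hfg : IsLeadingTerm D (f * g) δ 1) : IsLeadingTerm D g (δ - γ) 1 := by
  have hg : g ≠ 0 := by
    rintro rfl
    have := hfg.coeff_eq
    simp at this
  obtain ⟨ε, r, hr, h⟩ := exists_isLeadingTerm D hg
  obtain ⟨h1, h2⟩ := (hf.mul hD h).unique hD hfg (by simpa using hr) one_ne_zero
  rw [one_mul] at h2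
  rwa [← h1, add_sub_cancel_left, ← h2]

end IsLeadingTerm

/-- For each `i₀` there is a linear order on exponent vectors, compatible with addition, that
compares the entries at `i₀` before anything else. -/
lemma exists_injective_le [Fintype ι] (i₀ : ι) :
    ∃ D : (ι → ℤ) →+ ℤ ×ₗ Lex (Fin (Fintype.card ι) → ℤ), Function.Injective D ∧
      ∀ γ δ, D γ ≤ D δ → γ i₀ ≤ δ i₀ := by
  let σ := Fintype.equivFin ι
  refine ⟨{ toFun := fun γ => toLex (γ i₀, toLex fun i => γ (σ.symm i))
            map_zero' := rfl
            map_add' := fun _ _ => rfl }, fun γ δ h => ?_, fun γ δ h => ?_⟩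
  · have h1 := congrArg (fun z => ofLex (ofLex z).2) h
    ext i
    have h2 : γ (σ.symm (σ i)) = δ (σ.symm (σ i)) := congrFun h1 (σ i)
    rwa [σ.symm_apply_apply] at h2
  · rcases Prod.Lex.le_iff.mp h with h | h
    · exact h.le
    · exact h.1.le

section Exchange

variable {F : Type*} [Field F] [Algebra K F] [Fintype ι] {x y : ι → F}
  {a : ι → LaurentRing K ι} {g : ι → ι → ℤ} {β : ι → ℤ} {k : ι}

lemma laurentEval_prod_pow (hx : ∀ i, x i ≠ 0) (ha : ∀ i, laurentEval K x hx (a i) = y i)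
    {e : ι → ℤ} (he : 0 ≤ e) : laurentEval K x hx (∏ i, a i ^ (e i).toNat) = mon y e := by
  rw [map_prod, mon]
  refine Finset.prod_congr rfl fun i _ => ?_
  rw [map_pow, ha, ← zpow_natCast, Int.toNat_of_nonneg (he i)]

variable [IsOrderedAddMonoid Γ]

lemma isLeadingTerm_prod_pow (hD : Function.Injective D) (h : ∀ i, IsLeadingTerm D (a i) (g i) 1)
    {e : ι → ℤ} (he : 0 ≤ e) :
    IsLeadingTerm D (∏ i, a i ^ (e i).toNat) (∑ i, e i • g i) 1 := by
  have h1 := IsLeadingTerm.prod hD (fun i => (h i).pow hD (e i).toNat) Finset.univ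
  have h2 : ∑ i, (e i).toNat • g i = ∑ i, e i • g i := Finset.sum_congr rfl fun i _ => by
    rw [← natCast_zsmul, Int.toNat_of_nonneg (he i)]
  rwa [h2] at h1

variable [DecidableEq ι] [IsDomain K]

/-- The leading exponents of the two monomials in an exchange relation are distinct because the
leading exponents of the extended cluster are linearly independent; hence the new variable has
leading coefficient `1`, and the leading exponents of the new extended cluster are linearly
independent. If the order compares the entries at `i₀` first, then the entry at `i₀` of the new
leading exponent is `min (β⁺ i₀) (β⁻ i₀) = 0`. -/
lemma exists_isLeadingTerm_exchange (hD : Function.Injective D) (hx : ∀ i, x i ≠ 0)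
    (hind : AlgebraicIndependent K x) (ha : ∀ i, laurentEval K x hx (a i) = y i)
    (hlead : ∀ i, IsLeadingTerm D (a i) (g i) 1) (hlin : ∀ c : ι → ℤ, ∑ i, c i • g i = 0 → c = 0)
    (hβ : β ≠ 0) (hβk : β k = 0) {b : LaurentRing K ι} (hyk : y k ≠ 0)
    (hb : laurentEval K x hx b = exchangePoly y β / y k) :
    ∃ ε : ι → ℤ, IsLeadingTerm D b ε 1 ∧
      (∀ c : ι → ℤ, ∑ i, c i • Function.update g k ε i = 0 → c = 0) ∧
      ∀ i₀, i₀ ≠ k → (∀ γ δ, D γ ≤ D δ → γ i₀ ≤ δ i₀) →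
        (∀ i, g i i₀ = if i = i₀ then 1 else 0) → ε i₀ = 0 := by
  have hpos : 0 ≤ β⁺ := posPart_nonneg β
  have hneg : 0 ≤ β⁻ := negPart_nonneg β
  have hab : a k * b = ∏ i, a i ^ (β⁺ i).toNat + ∏ i, a i ^ (β⁻ i).toNat := by
    apply laurentEval_injective hx hind
    rw [map_mul, map_add, laurentEval_prod_pow hx ha hpos, laurentEval_prod_pow hx ha hneg, ha, hb,
      mul_div_cancel₀ _ hyk, exchangePoly]
  have hne : ∑ i, β⁺ i • g i ≠ ∑ i, β⁻ i • g i := fun h => hβ (hlin β (by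
    conv_lhs => rw [← posPart_sub_negPart β]
    simp only [Pi.sub_apply, sub_smul, Finset.sum_sub_distrib]
    rw [h, sub_self]))
  obtain ⟨δ, hδ, hδ1, hδ2, hδlead⟩ := (isLeadingTerm_prod_pow hD hlead hpos).exists_add hD
    (isLeadingTerm_prod_pow hD hlead hneg) hne
  rw [← hab] at hδlead
  obtain ⟨e, hek, he⟩ : ∃ e : ι → ℤ, e k = 0 ∧ δ = ∑ i, e i • g i := by
    rcases hδ with h | h
    · exact ⟨_, by simp [hβk], h⟩
    · exact ⟨_, by simp [hβk], h⟩
  refine ⟨δ - g k, (hlead k).of_mul hD hδlead, fun c hc => ?_, fun i₀ hi₀ hmono hg => ?_⟩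
  · have h1 : ∑ i, (c + c k • e - Pi.single k (2 * c k) : ι → ℤ) i • g i = 0 := by
      rw [← hc]
      have h2 : ∀ i, c i • Function.update g k (δ - g k) i =
          c i • g i + if i = k then c k • (δ - 2 • g k) else 0 := fun i => by
        by_cases hi : i = k
        · subst hi
          rw [Function.update_self, if_pos rfl]
          module
        · rw [Function.update_of_ne hi, if_neg hi, add_zero]
      rw [Finset.sum_congr rfl fun i _ => h2 i, Finset.sum_add_distrib, Finset.sum_ite_eq',
        if_pos (Finset.mem_univ k), he]
      simp only [Pi.add_apply, Pi.sub_apply, Pi.smul_apply, add_smul, sub_smul, smul_assoc,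
        Finset.sum_add_distrib, Finset.sum_sub_distrib, ← Finset.smul_sum, Pi.single_apply,
        ite_smul, zero_smul, Finset.sum_ite_eq', Finset.mem_univ, if_true]
      module
    have h2 := hlin _ h1
    have hk : c k = 0 := by
      have := congrFun h2 k
      simp [hek] at this
      omega
    simpa [hk] using h2
  · have hsum : ∀ c : ι → ℤ, (∑ i, c i • g i) i₀ = c i₀ := fun c => by
      simp [Finset.sum_apply, hg]
    have h1 := hmono _ _ hδ1
    have h2 := hmono _ _ hδ2
    rw [hsum, Pi.posPart_apply, posPart_def] at h1
    rw [hsum, Pi.negPart_apply, negPart_def] at h2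
    have h3 : 0 ≤ δ i₀ := by
      rcases hδ with h | h
      · rw [h, hsum]; exact hpos i₀
      · rw [h, hsum]; exact hneg i₀
    rw [Pi.sub_apply, hg, if_neg hi₀.symm]
    omega

end Exchange

end LeadingTerm

namespace Seed

variable {K F Γ : Type*} [CommRing K] [IsDomain K] [UniqueFactorizationMonoid K] [Field F] {n m : ℕ}
  [Algebra (CoeffRing K m) F] [Algebra K F] [IsScalarTower K (CoeffRing K m) F]
  [AddCommGroup Γ] [LinearOrder Γ] [IsOrderedAddMonoid Γ] {s : Seed n m F}
  {D : (Fin n ⊕ Fin m → ℤ) →+ Γ}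

lemma IsPrimitiveSeed.A_mem_upperClusterAlgebra (hs : s.IsPrimitiveSeed K) (t : List (Fin n))
    (k : Fin n) : (s.seedAt K t).A k ∈ s.upperClusterAlgebra K :=
  (hs.isPrimeGluing t).a_mem k

/-- As Laurent polynomials in the initial extended cluster, the elements of every extended cluster
have leading coefficient `1` and linearly independent leading exponents. If the order compares the
exponents of `Z_j` first, then `Z_j` does not occur in the leading exponent of a cluster
variable. -/
lemma IsPrimitiveSeed.exists_isLeadingTerm (hs : s.IsPrimitiveSeed K) (hD : Function.Injective D)
    (t : List (Fin n)) :
    ∃ (a : Fin n ⊕ Fin m → LaurentRing K (Fin n ⊕ Fin m)) (g : Fin n ⊕ Fin m → Fin n ⊕ Fin m → ℤ),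
      (∀ i, laurentEval K (s.extCluster K) hs.indep.ne_zero (a i) =
        (s.seedAt K t).extCluster K i) ∧
      (∀ i, IsLeadingTerm D (a i) (g i) 1) ∧ (∀ c : Fin n ⊕ Fin m → ℤ, ∑ i, c i • g i = 0 → c = 0) ∧
      ∀ j, (∀ γ δ, D γ ≤ D δ → γ (Sum.inr j) ≤ δ (Sum.inr j)) →
        ∀ i, g i (Sum.inr j) = if i = Sum.inr j then 1 else 0 := by
  induction t with
  | nil =>
    refine ⟨fun i => AddMonoidAlgebra.single (Pi.single i 1) 1, fun i => Pi.single i 1, fun i => ?_,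
      fun i => isLeadingTerm_single _ _, fun c hc => ?_, fun j _ i => ?_⟩
    · rw [laurentEval_single, one_smul, mon_single, zpow_one]
      rfl
    · rw [← hc]
      ext i
      simp [Finset.sum_apply, Pi.single_apply]
    · simp [Pi.single_apply, eq_comm]
  | cons k t ih =>
    obtain ⟨a, g, ha, hlead, hlin, hg⟩ := ih
    have ht := hs.seedAt t
    have hx := hs.indep.ne_zero
    have hmem : (s.seedAt K (k :: t)).A k ∈ s.laurentRing K :=
      ((hs.mem_upperClusterAlgebra_iff []).mp (hs.A_mem_upperClusterAlgebra (k :: t) k)).1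
    rw [mem_laurentRing_iff, mem_laurent_univ_iff hx] at hmem
    obtain ⟨b, hb⟩ := hmem
    have hmut : (s.seedAt K (k :: t)).extCluster K = _ := extCluster_mutate (s.seedAt K t) k
    have hb' := hb
    rw [← extCluster_inl (K := K) (s.seedAt K (k :: t)), hmut, Function.update_self] at hb'
    obtain ⟨ε, hε, hεlin, hε0⟩ := exists_isLeadingTerm_exchange hD hx hs.indep ha hlead hlin
      (ht.primitive k).ne_zero (ht.col_self k) (ht.indep.ne_zero _) hb'
    refine ⟨Function.update a (Sum.inl k) b, Function.update g (Sum.inl k) ε, fun i => ?_,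
      fun i => ?_, hεlin, fun j hj i => ?_⟩
    · by_cases hi : i = Sum.inl k
      · rw [hi, Function.update_self, hb]; rfl
      · rw [Function.update_of_ne hi, ha, hmut, Function.update_of_ne hi]
    · by_cases hi : i = Sum.inl k
      · rwa [hi, Function.update_self, Function.update_self]
      · rw [Function.update_of_ne hi, Function.update_of_ne hi]
        exact hlead i
    · by_cases hi : i = Sum.inl k
      · rw [hi, Function.update_self, hε0 _ (by simp) hj (hg j hj), if_neg (by simp)]
      · rw [Function.update_of_ne hi, hg j hj]

end Seed

/-! ### Polynomials and Laurent monomials -/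

section MvPolynomial

variable {K ι : Type*} [CommRing K]

lemma X_dvd_iff_forall_support {i : ι} {p : MvPolynomial ι K} :
    MvPolynomial.X i ∣ p ↔ ∀ d ∈ p.support, d i ≠ 0 := by
  rw [MvPolynomial.X_dvd_iff_modMonomial_eq_zero]
  constructor
  · intro h d hd hdi
    have h1 := MvPolynomial.coeff_modMonomial_of_not_le p (s' := d) (s := Finsupp.single i 1)
      (by rw [Finsupp.single_le_iff]; omega)
    rw [h, MvPolynomial.coeff_zero] at h1
    exact MvPolynomial.mem_support_iff.mp hd h1.symm
  · intro h
    ext d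
    by_cases hle : Finsupp.single i 1 ≤ d
    · rw [MvPolynomial.coeff_modMonomial_of_le _ hle, MvPolynomial.coeff_zero]
    · rw [MvPolynomial.coeff_modMonomial_of_not_le _ hle, MvPolynomial.coeff_zero]
      by_contra h0
      refine h d (MvPolynomial.mem_support_iff.mpr h0) ?_
      rw [Finsupp.single_le_iff] at hle
      omega

lemma exists_eq_monomial_mul [IsDomain K] {p : MvPolynomial ι K} (hp : p ≠ 0) :
    ∃ (e : ι →₀ ℕ) (q : MvPolynomial ι K), p = MvPolynomial.monomial e 1 * q ∧
      ∀ i, ¬ MvPolynomial.X i ∣ q := by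
  induction hN : p.totalDegree using Nat.strong_induction_on generalizing p with
  | _ N ih =>
    by_cases h : ∃ i, MvPolynomial.X i ∣ p
    · obtain ⟨i, q, rfl⟩ := h
      have hq : q ≠ 0 := right_ne_zero_of_mul hp
      rw [MvPolynomial.totalDegree_mul_of_isDomain (MvPolynomial.X_ne_zero i) hq,
        MvPolynomial.totalDegree_X] at hN
      obtain ⟨e, q', hq', hX⟩ := ih q.totalDegree (by omega) hq rfl
      refine ⟨Finsupp.single i 1 + e, q', ?_, hX⟩
      conv_lhs => rw [hq']
      rw [← mul_assoc, MvPolynomial.X, MvPolynomial.monomial_mul, one_mul]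
    · exact ⟨0, p, by simp, not_exists.mp h⟩

/-- A quotient of a polynomial by a Laurent monomial has only one expression with a numerator that
no variable divides. -/
lemma eq_of_aeval_div_eq {R F : Type*} [CommRing R] [IsDomain R] [Field F] [Algebra R F]
    [Fintype ι] {x : ι → F} (hx : AlgebraicIndependent R x) {d d' : ι → ℤ} {P P' : MvPolynomial ι R}
    (hP : ∀ i, ¬ MvPolynomial.X i ∣ P) (hP' : ∀ i, ¬ MvPolynomial.X i ∣ P')
    (h : MvPolynomial.aeval x P / ∏ i, x i ^ d i = MvPolynomial.aeval x P' / ∏ i, x i ^ d' i) :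
    P = P' := by
  classical
  have hx0 := hx.ne_zero
  have hd0 : ∀ e : ι → ℤ, ∏ i, x i ^ e i ≠ 0 := mon_ne_zero hx0
  have hmul : P * ∏ i, MvPolynomial.X i ^ (d' i - d i).toNat =
      P' * ∏ i, MvPolynomial.X i ^ (d i - d' i).toNat := by
    apply hx
    rw [div_eq_div_iff (hd0 _) (hd0 _)] at h
    simp only [map_mul, map_prod, map_pow, MvPolynomial.aeval_X]
    have h1 : ∀ e e' : ι → ℤ, ∏ i, x i ^ (e' i - e i).toNat =
        (∏ i, x i ^ e' i) * ∏ i, x i ^ (-min (e i) (e' i)) := fun e e' => by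
      rw [← Finset.prod_mul_distrib]
      refine Finset.prod_congr rfl fun i _ => ?_
      rw [← zpow_add₀ (hx0 i), ← zpow_natCast]
      congr 1
      omega
    rw [h1 d d', h1 d' d, ← mul_assoc, ← mul_assoc, h]
    simp only [min_comm]
  have key : ∀ {d d' : ι → ℤ} {P P' : MvPolynomial ι R}, (∀ i, ¬ MvPolynomial.X i ∣ P') →
      P * ∏ i, MvPolynomial.X i ^ (d' i - d i).toNat =
      P' * ∏ i, MvPolynomial.X i ^ (d i - d' i).toNat → ∀ i, d' i ≤ d i := by
    intro d d' P P' hP' hmul i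
    by_contra! hlt
    have h1 : (MvPolynomial.X i : MvPolynomial ι R) ∣
        P' * ∏ i, MvPolynomial.X i ^ (d i - d' i).toNat := by
      rw [← hmul]
      have h0 : (d' i - d i).toNat ≠ 0 := by omega
      exact Dvd.dvd.mul_left ((dvd_pow_self _ h0).trans
        (Finset.dvd_prod_of_mem (fun i => MvPolynomial.X i ^ (d' i - d i).toNat)
          (Finset.mem_univ i))) _
    rcases (MvPolynomial.X_prime).dvd_or_dvd h1 with h2 | h2
    · exact hP' i h2
    · obtain ⟨j, -, hj⟩ := (MvPolynomial.X_prime).exists_mem_finset_dvd h2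
      have hij := MvPolynomial.X_dvd_X.mp ((MvPolynomial.X_prime).dvd_of_dvd_pow hj)
      subst hij
      rw [Int.toNat_of_nonpos (by omega), pow_zero] at hj
      exact (MvPolynomial.X_prime (R := R) (i := i)).not_isUnit (isUnit_of_dvd_one hj)
  have h1 := key hP' hmul
  have h2 := key hP hmul.symm
  have h3 : d = d' := funext fun i => le_antisymm (h2 i) (h1 i)
  rw [h3] at h
  exact hx ((div_left_inj' (hd0 _)).mp h)

end MvPolynomial

namespace LaurentRing

variable {K ι : Type*} [CommRing K]

lemma coeff_single_mul_ofMvPolynomial (e : ι → ℤ) (p : MvPolynomial ι K) (d : ι →₀ ℕ) :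
    (AddMonoidAlgebra.single e 1 * ofMvPolynomial K ι p).coeff (e + fun i => (d i : ℤ)) =
      p.coeff d := by
  rw [AddMonoidAlgebra.coeff_single_mul_add, one_mul]
  refine Finsupp.mapDomain_apply (f := fun (e : ι →₀ ℕ) (i : ι) => (e i : ℤ)) (fun e e' h => ?_)
    (AddMonoidAlgebra.coeff p) d
  ext i
  exact Int.ofNat_inj.mp (congrFun h i)

lemma exists_eq_add_of_coeff_ne_zero {e δ : ι → ℤ} {p : MvPolynomial ι K}
    (h : (AddMonoidAlgebra.single e 1 * ofMvPolynomial K ι p).coeff δ ≠ 0) :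
    ∃ d : ι →₀ ℕ, δ = e + fun i => (d i : ℤ) := by
  rw [← add_sub_cancel e δ, AddMonoidAlgebra.coeff_single_mul_add, one_mul] at h
  by_contra hne
  refine h (Finsupp.mapDomain_of_notMem_range (f := fun (e : ι →₀ ℕ) (i : ι) => (e i : ℤ))
    (AddMonoidAlgebra.coeff p) (δ - e) ?_)
  rintro ⟨d, hd⟩
  exact hne ⟨d, (eq_add_of_sub_eq' hd.symm)⟩

variable [IsDomain K]

lemma exists_eq_monomial_of_isUnit [Fintype ι] {p : MvPolynomial ι K}
    (hp : IsUnit (ofMvPolynomial K ι p)) :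
    ∃ (e : ι →₀ ℕ) (r : K), IsUnit r ∧ p = MvPolynomial.monomial e r := by
  obtain ⟨f, hf⟩ := hp.exists_right_inv
  obtain ⟨e, q, hq⟩ := exists_mul_single_eq f
  have h : p * q = MvPolynomial.monomial e 1 := by
    apply ofMvPolynomial_injective
    rw [map_mul, ← hq, ← mul_assoc, hf, one_mul, ofMvPolynomial_monomial]
  obtain ⟨e', r, -, hr, rfl⟩ := MvPolynomial.dvd_monomial_one_iff_exists.mp (Dvd.intro q h)
  exact ⟨e', r, hr, rfl⟩

lemma exists_eq_single_of_isUnit [Fintype ι] {f : LaurentRing K ι} (hf : IsUnit f) :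
    ∃ (e : ι → ℤ) (r : K), f = AddMonoidAlgebra.single e r := by
  obtain ⟨e, p, hp⟩ := exists_mul_single_eq f
  obtain ⟨e', r, -, rfl⟩ := exists_eq_monomial_of_isUnit (p := p)
    (hp ▸ hf.mul (isUnit_single fun i => (e i : ℤ)))
  refine ⟨(fun i => (e' i : ℤ)) - fun i => (e i : ℤ), r, ?_⟩
  apply (isUnit_single (K := K) fun i => (e i : ℤ)).mul_right_cancel
  rw [hp, ofMvPolynomial_monomial, AddMonoidAlgebra.single_mul_single, sub_add_cancel, mul_one]

/-- A polynomial which is divisible by no variable and is irreducible as a Laurent polynomial is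
irreducible. -/
lemma irreducible_of_ofMvPolynomial [Fintype ι] {p : MvPolynomial ι K}
    (hX : ∀ i, ¬ MvPolynomial.X i ∣ p) (hp : Irreducible (ofMvPolynomial K ι p)) :
    Irreducible p := by
  have key : ∀ a, a ∣ p → IsUnit (ofMvPolynomial K ι a) → IsUnit a := fun a hap ha => by
    obtain ⟨e, r, hr, rfl⟩ := exists_eq_monomial_of_isUnit ha
    have he : e = 0 := by
      ext i
      by_contra h
      exact hX i (dvd_trans (MvPolynomial.X_dvd_monomial.mpr (Or.inr h)) hap)
    rw [he]
    exact hr.map MvPolynomial.C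
  refine ⟨fun h => hp.not_isUnit (h.map _), fun a b hab => ?_⟩
  rw [hab, map_mul] at hp
  exact (hp.isUnit_or_isUnit rfl).imp (key a ⟨b, hab⟩) (key b ⟨a, by rw [hab, mul_comm]⟩)

end LaurentRing

/-! ### Cluster variables as irreducible polynomials -/

namespace Seed

variable {K F : Type*} [CommRing K] [IsDomain K] [UniqueFactorizationMonoid K] [Field F] {n m : ℕ}
  [Algebra (CoeffRing K m) F] [Algebra K F] [IsScalarTower K (CoeffRing K m) F]
  {s : Seed n m F}

namespace IsPrimitiveSeed

variable (hs : s.IsPrimitiveSeed K)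
include hs

/-- The least exponent of `Z_j` in a cluster variable, written as a Laurent polynomial in the
initial extended cluster, is `0`. -/
lemma exists_exponent_eq_zero (t : List (Fin n)) (k : Fin n)
    {f : LaurentRing K (Fin n ⊕ Fin m)}
    (hf : laurentEval K (s.extCluster K) hs.indep.ne_zero f = (s.seedAt K t).A k) (j : Fin m) :
    (∃ δ, f.coeff δ ≠ 0 ∧ δ (Sum.inr j) = 0) ∧ ∀ δ, f.coeff δ ≠ 0 → 0 ≤ δ (Sum.inr j) := by
  obtain ⟨D, hD, hmono⟩ := exists_injective_le (Sum.inr j : Fin n ⊕ Fin m)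
  obtain ⟨a, g, ha, hlead, -, hg⟩ := hs.exists_isLeadingTerm hD t
  have hfa : f = a (Sum.inl k) :=
    laurentEval_injective hs.indep.ne_zero hs.indep (hf.trans (ha (Sum.inl k)).symm)
  have h0 : g (Sum.inl k) (Sum.inr j) = 0 := by
    rw [hg j hmono, if_neg (by simp)]
  have h1 := hlead (Sum.inl k)
  rw [← hfa] at h1
  refine ⟨⟨_, by rw [h1.coeff_eq]; exact one_ne_zero, h0⟩, fun δ hδ => ?_⟩
  rw [← h0]
  exact hmono _ _ (h1.le δ hδ)

/-- A cluster variable that is a Laurent monomial in the initial extended cluster has coefficient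
`1`. -/
lemma eq_one_of_laurentEval_single (t : List (Fin n)) (k : Fin n) {e : Fin n ⊕ Fin m → ℤ} {r : K}
    (h : laurentEval K (s.extCluster K) hs.indep.ne_zero (AddMonoidAlgebra.single e r) =
      (s.seedAt K t).A k) : r = 1 := by
  obtain ⟨D, hD, -⟩ := exists_injective_le (Sum.inl k : Fin n ⊕ Fin m)
  obtain ⟨a, g, ha, hlead, -, -⟩ := hs.exists_isLeadingTerm hD t
  have hfa : AddMonoidAlgebra.single e r = a (Sum.inl k) :=
    laurentEval_injective hs.indep.ne_zero hs.indep (h.trans (ha (Sum.inl k)).symm)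
  have h1 := hlead (Sum.inl k)
  rw [← hfa] at h1
  have hr : r ≠ 0 := by
    rintro rfl
    have := h1.coeff_eq
    simp at this
  exact ((isLeadingTerm_single e r).unique hD h1 hr one_ne_zero).2

/-- A cluster variable which is not in the initial cluster is a prime element of the initial Laurent
polynomial ring. -/
lemma prime_clusterVariable (t : List (Fin n)) (k : Fin n)
    (hM : (s.seedAt K t).A k ∉ Set.range s.A)
    {f : LaurentRing K (Fin n ⊕ Fin m)}
    (hf : laurentEval K (s.extCluster K) hs.indep.ne_zero f = (s.seedAt K t).A k) : Prime f := by
  have hx := hs.indep.ne_zero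
  have h0 : IsPrimeGluing ((s.upperClusterAlgebra K).restrictScalars K)
      (laurent K (s.extCluster K) Set.univ) _ s.A := hs.isPrimeGluing []
  rcases h0.prime_cases _ ((hs.isPrimeGluing t).prime_a k) with ⟨i, u, hu, hMu⟩ | hprime
  -- A unit of the upper cluster algebra is a Laurent monomial in the initial extended cluster. If
  -- its product with `A_i` is a cluster variable, then coefficient and exponents of the `Z_j` are
  -- trivial, and so are the other exponents because each `A_l` is a nonunit next to the initial
  -- seed.
  · refine absurd ⟨i, ?_⟩ hM
    obtain ⟨v, huv⟩ := hu.exists_right_inv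
    have huv' : (u : F) * v = 1 := congrArg Subtype.val huv
    obtain ⟨f', hf'⟩ := (mem_laurent_univ_iff hx).mp (h0.le₀ u.2)
    obtain ⟨g', hg'⟩ := (mem_laurent_univ_iff hx).mp (h0.le₀ v.2)
    have hfg : f' * g' = 1 := laurentEval_injective hx hs.indep (by
      rw [map_mul, map_one, hf', hg', huv'])
    obtain ⟨e, r, rfl⟩ := LaurentRing.exists_eq_single_of_isUnit (IsUnit.of_mul_eq_one _ hfg)
    have hMs : laurentEval K (s.extCluster K) hx
        (AddMonoidAlgebra.single (e + Pi.single (Sum.inl i) 1) r) = (s.seedAt K t).A k := by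
      rw [hMu, ← hf', laurentEval_single, laurentEval_single, mon_add hx, mon_single, zpow_one,
        smul_mul_assoc, extCluster_inl]
    have hr := hs.eq_one_of_laurentEval_single t k hMs
    have heZ : ∀ j, e (Sum.inr j) = 0 := fun j => by
      obtain ⟨⟨δ, hδ, hδj⟩, -⟩ := hs.exists_exponent_eq_zero t k hMs j
      rw [AddMonoidAlgebra.coeff_single, Finsupp.single_apply] at hδ
      split_ifs at hδ with h
      · rw [← h] at hδj
        simpa using hδj
      · exact absurd rfl hδ
    have hu1 : (u : F) = ∏ l, s.A l ^ e (Sum.inl l) := by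
      rw [← hf', laurentEval_single, hr, one_smul, mon, Fintype.prod_sum_type]
      simp [heZ]
    have hv1 : (v : F) = ∏ l, s.A l ^ (-e (Sum.inl l)) := by
      rw [eq_inv_of_mul_eq_one_right huv', hu1, ← Finset.prod_inv_distrib]
      exact Finset.prod_congr rfl fun l _ => (zpow_neg _ _).symm
    have hpure : IsPrimeGluing.Pure ((s.upperClusterAlgebra K).restrictScalars K)
        (fun k => laurent K ((s.seedAt K (k :: [])).extCluster K) Set.univ) s.A 1 :=
      ⟨one_mem _, fun k => by rw [one_div]; exact h0.inv_notMem k⟩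
    have he : ∀ l, e (Sum.inl l) = 0 := fun l => by
      have h1 := h0.exponent_nonneg hpure (e := fun l => e (Sum.inl l))
        (by rw [one_mul, ← hu1]; exact u.2) l
      have h2 := h0.exponent_nonneg hpure (e := fun l => -e (Sum.inl l))
        (by rw [one_mul, ← hv1]; exact v.2) l
      omega
    rw [hMu, hu1]
    simp [he]
  · rw [← MulEquiv.prime_iff (laurentEquiv hx hs.indep)]
    convert hprime
    exact hf

/-- A cluster variable which is not in the initial cluster is an irreducible polynomial in the
initial extended cluster, divided by a monomial in the initial cluster. -/
lemma exists_irreducible_aeval_eq (t : List (Fin n)) (k : Fin n)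
    (hM : (s.seedAt K t).A k ∉ Set.range s.A) :
    ∃ (d : Fin n → ℤ) (Q : MvPolynomial (Fin n ⊕ Fin m) K), Irreducible Q ∧
      (∀ i, ¬ MvPolynomial.X i ∣ Q) ∧
      (s.seedAt K t).A k = MvPolynomial.aeval (s.extCluster K) Q / ∏ j, s.A j ^ d j := by
  have hx := hs.indep.ne_zero
  have hmem : (s.seedAt K t).A k ∈ s.laurentRing K :=
    ((hs.mem_upperClusterAlgebra_iff []).mp (hs.A_mem_upperClusterAlgebra t k)).1
  rw [mem_laurentRing_iff, mem_laurent_univ_iff hx] at hmem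
  obtain ⟨f, hf⟩ := hmem
  have hprime := hs.prime_clusterVariable t k hM hf
  obtain ⟨e₁, p, hp⟩ := LaurentRing.exists_mul_single_eq f
  have hunit := fun e : Fin n ⊕ Fin m → ℤ => LaurentRing.isUnit_single (K := K) e
  have hp0 : p ≠ 0 := by
    rintro rfl
    rw [map_zero, (hunit _).mul_left_eq_zero] at hp
    exact hprime.ne_zero hp
  obtain ⟨e₂, Q, rfl, hX⟩ := exists_eq_monomial_mul hp0
  set e : Fin n ⊕ Fin m → ℤ := (fun i => (e₂ i : ℤ)) - fun i => (e₁ i : ℤ)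
  have hfQ : f = AddMonoidAlgebra.single e 1 * LaurentRing.ofMvPolynomial K _ Q := by
    apply (hunit fun i => (e₁ i : ℤ)).mul_right_cancel
    rw [hp, map_mul, LaurentRing.ofMvPolynomial_monomial, mul_right_comm,
      AddMonoidAlgebra.single_mul_single, sub_add_cancel, mul_one]
  have hirr : Irreducible (LaurentRing.ofMvPolynomial K _ Q) := by
    have h1 := hprime.irreducible
    rwa [hfQ, irreducible_isUnit_mul (hunit e)] at h1
  have heZ : ∀ j, e (Sum.inr j) = 0 := fun j => by
    obtain ⟨⟨δ, hδ, hδj⟩, hnonneg⟩ := hs.exists_exponent_eq_zero t k hf j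
    refine le_antisymm ?_ ?_
    · rw [hfQ] at hδ
      obtain ⟨d, rfl⟩ := LaurentRing.exists_eq_add_of_coeff_ne_zero hδ
      have h1 : e (Sum.inr j) + (d (Sum.inr j) : ℤ) = 0 := hδj
      omega
    · have h1 := hX (Sum.inr j)
      rw [X_dvd_iff_forall_support] at h1
      push Not at h1
      obtain ⟨d, hd, hdj⟩ := h1
      have h2 := hnonneg (e + fun i => (d i : ℤ)) (by
        rw [hfQ, LaurentRing.coeff_single_mul_ofMvPolynomial]
        exact MvPolynomial.mem_support_iff.mp hd)
      simpa [hdj] using h2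
  refine ⟨fun j => -e (Sum.inl j), Q, LaurentRing.irreducible_of_ofMvPolynomial hX hirr, hX, ?_⟩
  rw [← hf, hfQ, map_mul, laurentEval_single, one_smul, laurentEval_ofMvPolynomial, mon,
    Fintype.prod_sum_type, mul_comm, div_eq_mul_inv, ← Finset.prod_inv_distrib]
  simp [heZ]

end IsPrimitiveSeed

end Seed

section Numerator

variable {K F : Type*} [CommRing K] [Field F] {n m : ℕ}
  [Algebra (CoeffRing K m) F] [Algebra K F] [IsScalarTower K (CoeffRing K m) F]

/-- Evaluating at the cluster a polynomial over `K[Z_1, …, Z_m]` amounts to evaluating at the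
extended cluster the corresponding polynomial over `K`. -/
lemma aeval_polyInclusion (s : Seed n m F) (Q : MvPolynomial (Fin n ⊕ Fin m) K) :
    MvPolynomial.aeval s.A (polyInclusion K n m (MvPolynomial.sumAlgEquiv K (Fin n) (Fin m) Q)) =
      MvPolynomial.aeval (s.extCluster K) Q := by
  induction Q using MvPolynomial.induction_on with
  | C a =>
    rw [MvPolynomial.sumAlgEquiv_C_inl, polyInclusion, MvPolynomial.map_C, MvPolynomial.aeval_C,
      MvPolynomial.aeval_C, IsScalarTower.algebraMap_apply K (CoeffRing K m) F]
    congr 1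
    exact MvPolynomial.aeval_C _ _
  | add p q hp hq => simp only [map_add, hp, hq]
  | mul_X p i hp =>
    simp only [map_mul, hp]
    congr 1
    rcases i with i | i
    · rw [MvPolynomial.sumAlgEquiv_X_inl, polyInclusion, MvPolynomial.map_X, MvPolynomial.aeval_X,
        MvPolynomial.aeval_X, Seed.extCluster_inl]
    · rw [MvPolynomial.sumAlgEquiv_X_inr, polyInclusion, MvPolynomial.map_C, MvPolynomial.aeval_C,
        MvPolynomial.aeval_X, Seed.extCluster_inr, Seed.coeff]
      congr 1
      exact MvPolynomial.aeval_X _ _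

lemma X_dvd_polyInclusion_iff {i : Fin n} {Q : MvPolynomial (Fin n ⊕ Fin m) K} :
    MvPolynomial.X i ∣ polyInclusion K n m (MvPolynomial.sumAlgEquiv K (Fin n) (Fin m) Q) ↔
      MvPolynomial.X (Sum.inl i) ∣ Q := by
  rw [X_dvd_iff_forall_support, polyInclusion,
    MvPolynomial.support_map_of_injective _ (polyToCoeffRing_injective K m),
    ← X_dvd_iff_forall_support, ← MvPolynomial.sumAlgEquiv_X_inl, map_dvd_iff]

end Numerator

lemma isDomain_and_uniqueFactorizationMonoid {K : Type*} [CommRing K]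
    (hK : IsField K ∨ Nonempty (K ≃+* ℤ)) : IsDomain K ∧ UniqueFactorizationMonoid K := by
  rcases hK with hK | ⟨⟨e⟩⟩
  · let _ := hK.toField
    exact ⟨inferInstance, inferInstance⟩
  · have : IsDomain K := e.injective.isDomain e
    exact ⟨this, e.symm.toMulEquiv.uniqueFactorizationMonoid inferInstance⟩

end ClusterAlgebra


theorem theorem4p6 {K F : Type*} [CommRing K] [CharZero K]
    (hK : IsField K ∨ Nonempty (K ≃+* ℤ)) {n m : ℕ}
    [Field F] [Algebra (ClusterAlgebra.CoeffRing K m) F]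
    (s₀ : ClusterAlgebra.Seed n m F) (hs₀ : s₀.IsASeed K)
    (hfull : s₀.FullRank) (hprim : s₀.Primitive) :
    UniqueFactorizationMonoid (s₀.upperClusterAlgebra K) ∧
    ∀ M ∈ s₀.clusterVariables K, M ∉ Set.range s₀.A →
      (∃ d P, s₀.IsNumerator K M d P) ∧
      ∀ d P, s₀.IsNumerator K M d P →
        ∃ Q : MvPolynomial (Fin n) (MvPolynomial (Fin m) K),
          ClusterAlgebra.polyInclusion K n m Q = P ∧ Irreducible Q := by
  obtain ⟨_, _⟩ := ClusterAlgebra.isDomain_and_uniqueFactorizationMonoid hK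
  -- `F` is a `K`-algebra through the ring of coefficients.
  let _ : Algebra K F := ((algebraMap (ClusterAlgebra.CoeffRing K m) F).comp
    (algebraMap K (ClusterAlgebra.CoeffRing K m))).toAlgebra
  have _ : IsScalarTower K (ClusterAlgebra.CoeffRing K m) F := .of_algebraMap_eq fun _ => rfl
  have _ : IsDomain (ClusterAlgebra.CoeffRing K m) :=
    hs₀.algebraicIndependent.algebraMap_injective.isDomain _
  have hs := hs₀.isPrimitiveSeed hfull hprim
  refine ⟨?_, ?_⟩
  · have : UniqueFactorizationMonoid (ClusterAlgebra.laurent K (s₀.extCluster K) Set.univ) :=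
      hs.uniqueFactorizationMonoid_laurent
    have : UniqueFactorizationMonoid
        (ClusterAlgebra.laurent K ((s₀.seedAt K []).extCluster K) Set.univ) := this
    exact (hs.isPrimeGluing []).uniqueFactorizationMonoid
  · rintro _ ⟨t, k, rfl⟩ hM
    obtain ⟨d, Q, hQ, hX, hMQ⟩ := hs.exists_irreducible_aeval_eq t k hM
    have hX' : ∀ i, ¬ MvPolynomial.X i ∣ ClusterAlgebra.polyInclusion K n m
        (MvPolynomial.sumAlgEquiv K (Fin n) (Fin m) Q) := fun i h =>
      hX _ (ClusterAlgebra.X_dvd_polyInclusion_iff.mp h)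
    rw [← ClusterAlgebra.aeval_polyInclusion] at hMQ
    refine ⟨⟨d, _, hX', hMQ⟩, fun d' P hP => ⟨_, ?_,
      (MulEquiv.irreducible_iff (MvPolynomial.sumAlgEquiv K (Fin n) (Fin m))).mpr hQ⟩⟩
    exact ClusterAlgebra.eq_of_aeval_div_eq hs₀.algebraicIndependent hX' hP.1
      (hMQ.symm.trans hP.2)
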